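/- **Setting.** Units are $G=c=1$. Consider spacetimes with metric ${}^4g=-dt^2+g_{ab}(t)W^aW^b$, where $W^a$ is dual to a left-invariant frame $E_a$ $(a=1,2,3)$ with $[E_b,E_c]=C^d_{bc}E_d$, of Bianchi type V: $C^d_{bc}=a_b\delta^d_c-a_c\delta^d_b$, $(a_1,a_2,a_3)=(1,0,0)$. Matter consists of collisionless particles of unit mass with distribution function $f(t,p)\ge 0$, $p=(p_1,p_2,p_3)$, compactly supported in $p$ for each $t$. Write $|p|^2=g^{ab}p_ap_b$, $p^0=\sqrt{1+|p|^2}$ and, with $d\mu=(\det g)^{-1/2}dp_1dp_2dp_3$, $$\rho=\int f\,p^0\,d\mu,\qquad j_a=\int f\,p_a\,d\mu,\qquad S_{ab}=\int f\,\frac{p_ap_b}{p^0}\,d\mu,\qquad S=g^{ab}S_{ab}.$$ A $C^\infty$ solution $(g,k,f)$ of the Einstein–Vlasov system on $[t_0,\infty)$ satisfies, with $R_{ab}$, $R$, $\nabla$ the Ricci and scalar curvature and the Levi-Civita connection of $g_{ab}(t)W^aW^b$ and $k=g^{ab}k_{ab}$, $$\dot g_{ab}=-2k_{ab},\qquad \dot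 k_{ab}=R_{ab}+k\,k_{ab}-2k_{ac}k^c_b-8\pi\left(S_{ab}-\tfrac12 g_{ab}S\right)-4\pi\rho g_{ab},$$ $$R-k_{ab}k^{ab}+k^2=16\pi\rho,\qquad \nabla^ak_{ab}=8\pi j_b,\qquad \partial_tf+(p^0)^{-1}C^d_{ba}p^bp_d\,\frac{\partial f}{\partial p_a}=0 .$$ Assume $k(t_0)<0$ and, by choice of the origin of time, $t_0=-3/k(t_0)$. Let $$H=-\tfrac13k,\quad \sigma_{ab}=k_{ab}+Hg_{ab},\quad \Sigma^i_j=\sigma^i_j/H,\quad \Sigma_+=-\tfrac12(\Sigma^2_2+\Sigma^3_3),\quad \Sigma_-=-\tfrac1{2\sqrt3}(\Sigma^2_2-\Sigma^3_3),$$ $$A=-\frac{R}{6H^2},\quad \tilde A=1-A,\quad \mathrm P(t)=\sup\{|p| : f(t,p)\ne0\}\ \ (\mathrm P=0\text{ if }f(t,\cdot)\equiv0).$$ The Milne solution is $g_{ij}=t^2\delta_{ij}$, $f=0$, for which $H=1/t$, $\Sigma^a_b=0$, $A=1$. Call the data at $t_0$ $\delta$-small if $|\Sigma_\pm(t_0)|$,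 $|\Sigma^i_j(t_0)|$ for all $i\neq j$, $|A(t_0)-1|$ and $\mathrm P(t_0)$ are all less than $\delta$. **Theorem.** There are constants $\varepsilon_0,\delta_0>0$ such that every such solution with $\delta_0$-small data at $t_0$ satisfies, for every $0<\varepsilon\le\varepsilon_0$, as $t\to\infty$ (with constants in the $O$-terms that may depend on the solution and on $\varepsilon$): $$H(t)=t^{-1}(1+O(t^{-\varepsilon})),\quad \Sigma_+=O(t^{-2}),\quad \Sigma_-=O(t^{-2}),\quad \Sigma^i_j=O(t^{-2})\ (i\ne j),\quad \tilde A=O(t^{-\varepsilon}),\quad \mathrm P=O(t^{-1/2}).$$ The solution thus tends to the Milne solution: as $t\to\infty$, $tH\to1$, $\Sigma^a_b\to0$ for all $a,b$, $A\to1$ and $\mathrm P\to0$. Moreover the Milne solution is stable: for every $\eta>0$ there is $\delta>0$ such that every such solution with $\delta$-small data at $t_0$ satisfies, for all $t\ge t_0$, $$|tH-1|<\eta,\qquad (\Sigma^a_b\Sigma^b_a)^{1/2}<\eta,\qquad |A-1|<\eta,\qquad \mathrm P<\eta .$$ -/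

import Mathlib

open Set Filter Topology MeasureTheory
open scoped ContDiff

/-! Locally spatially homogeneous spacetimes `-dt² + g_ab(t) W^a W^b`, where `W^a` is dual to a
left-invariant frame `E_a` of a three-dimensional Lie group with `[E_b, E_c] = C^d_bc E_d`.
All tensors are given by their frame components; frame index `i ∈ {1, 2, 3}` is `i - 1 : Fin 3`. -/

namespace Bianchi

noncomputable section

/-- `3 × 3` real matrices: frame components of two-index spatial tensors. -/
abbrev Mat := Matrix (Fin 3) (Fin 3) ℝ

/-- Momentum covectors `(p_1, p_2, p_3)`, with Lebesgue measure `dp_1 dp_2 dp_3`. -/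
abbrev Mom := Fin 3 → ℝ

/-! ### Geometry of a left-invariant Riemannian metric -/

/-- Structure constants `C d b c = C^d_bc` of Bianchi type V:
`C^d_bc = a_b δ^d_c - a_c δ^d_b` with `(a_1, a_2, a_3) = (1, 0, 0)`. -/
def structV (d b c : Fin 3) : ℝ :=
  (if b = 0 ∧ d = c then 1 else 0) - (if c = 0 ∧ d = b then 1 else 0)

/-- `Γ_abc = ⟨E_a, ∇_{E_c} E_b⟩` for the Levi-Civita connection (Koszul's formula; the frame
components of the metric are constant along the group). -/
def connLow (C : Fin 3 → Fin 3 → Fin 3 → ℝ) (g : Mat) (a b c : Fin 3) : ℝ :=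
  (1 / 2) * ∑ d, (C d c b * g a d + C d a c * g b d - C d b a * g c d)

/-- `Γ^d_bc`, that is `∇_{E_c} E_b = Γ^d_bc E_d`. -/
def conn (C : Fin 3 → Fin 3 → Fin 3 → ℝ) (g : Mat) (d b c : Fin 3) : ℝ :=
  ∑ a, g⁻¹ d a * connLow C g a b c

/-- The Ricci tensor `R_bc`, the trace over `a` of `X = E_a ↦ R(X, E_c) E_b`, with
`R(X, Y) = ∇_X ∇_Y - ∇_Y ∇_X - ∇_[X, Y]`. -/
def ricci (C : Fin 3 → Fin 3 → Fin 3 → ℝ) (g : Mat) : Mat := fun b c =>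
  ∑ a, ∑ e, (conn C g e b c * conn C g a e a - conn C g e b a * conn C g a e c
    - C e a c * conn C g a b e)

/-- The trace `g^ab h_ab` of a two-index tensor. -/
def trg (g h : Mat) : ℝ := ∑ a, ∑ b, g⁻¹ a b * h a b

/-- The scalar curvature `R = g^ab R_ab`. -/
def scalarR (C : Fin 3 → Fin 3 → Fin 3 → ℝ) (g : Mat) : ℝ := trg g (ricci C g)

/-- The mixed components `h^a_b = g^ac h_cb`. -/
def mixed (g h : Mat) : Mat := g⁻¹ * h

/-- The divergence `∇^a h_ab = g^ac (∇_c h)_ab` of a left-invariant two-index tensor. -/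
def divg (C : Fin 3 → Fin 3 → Fin 3 → ℝ) (g h : Mat) (b : Fin 3) : ℝ :=
  ∑ a, ∑ c, g⁻¹ a c * ∑ d, (-(conn C g d a c * h d b) - conn C g d b c * h a d)

/-! ### Kinetic matter of unit mass -/

/-- `p^a = g^ab p_b`. -/
def raise (g : Mat) (p : Mom) (a : Fin 3) : ℝ := ∑ b, g⁻¹ a b * p b

/-- `|p|² = g^ab p_a p_b`. -/
def normSq (g : Mat) (p : Mom) : ℝ := ∑ a, ∑ b, g⁻¹ a b * p a * p b

/-- `p^0` on the mass shell `p_α p^α = -1`, `p^0 > 0`. -/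
def energy (g : Mat) (p : Mom) : ℝ := Real.sqrt (1 + normSq g p)

/-- The integral against `√(det g) dp^1 dp^2 dp^3 = (√(det g))⁻¹ dp_1 dp_2 dp_3`. -/
def momInt (g : Mat) (F : Mom → ℝ) : ℝ := (Real.sqrt g.det)⁻¹ * ∫ p, F p

/-- The energy density `ρ = T^00`. -/
def rho (g : Mat) (f : Mom → ℝ) : ℝ := momInt g fun p => f p * energy g p

/-- The matter current `j_a = T_a^0`. -/
def current (g : Mat) (f : Mom → ℝ) (a : Fin 3) : ℝ := momInt g fun p => f p * p a

/-- The spatial part `S_ab = T_ab` of the energy-momentum tensor. -/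
def stress (g : Mat) (f : Mom → ℝ) : Mat := fun a b =>
  momInt g fun p => f p * p a * p b / energy g p

/-- The supremum `P` of the momenta `|p| = (g^ab p_a p_b)^(1/2)` in the support of `f`
(equal to `0` in vacuum). -/
def supMom (g : Mat) (f : Mom → ℝ) : ℝ :=
  sSup {x : ℝ | ∃ p : Mom, f p ≠ 0 ∧ x = Real.sqrt (normSq g p)}

/-! ### The Einstein-Vlasov system -/

/-- A smooth solution of the Einstein-Vlasov system, in 3+1 form with unit lapse and zero shift,
on the time interval `[t₀, ∞)`: `g` is the spatial metric, `k` the second fundamental form and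
`f t p` the distribution function in terms of the covariant momentum components. Time derivatives
are one-sided at `t₀`. -/
structure IsSolution (C : Fin 3 → Fin 3 → Fin 3 → ℝ) (t₀ : ℝ) (g k : ℝ → Mat)
    (f : ℝ → Mom → ℝ) : Prop where
  posDef : ∀ t ∈ Ici t₀, (g t).PosDef
  smooth_g : ∀ a b, ContDiffOn ℝ ∞ (fun t => g t a b) (Ici t₀)
  smooth_k : ∀ a b, ContDiffOn ℝ ∞ (fun t => k t a b) (Ici t₀)
  smooth_f : ContDiffOn ℝ ∞ (fun x : ℝ × Mom => f x.1 x.2) (Ici t₀ ×ˢ univ)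
  f_nonneg : ∀ t ∈ Ici t₀, ∀ p, 0 ≤ f t p
  compactSupp : ∀ t ∈ Ici t₀, HasCompactSupport (f t)
  /-- `∂_t g_ab = -2 k_ab` -/
  metric_eq : ∀ t ∈ Ici t₀, ∀ a b,
    HasDerivWithinAt (fun s => g s a b) (-2 * k t a b) (Ici t₀) t
  /-- `∂_t k_ab = R_ab + k k_ab - 2 k_ac k^c_b - 8π (S_ab - ½ g_ab S) - 4π ρ g_ab` -/
  evolution_eq : ∀ t ∈ Ici t₀, ∀ a b,
    HasDerivWithinAt (fun s => k s a b)
      (ricci C (g t) a b + trg (g t) (k t) * k t a b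
        - 2 * ∑ c, k t a c * mixed (g t) (k t) c b
        - 8 * Real.pi * (stress (g t) (f t) a b
            - (1 / 2) * g t a b * trg (g t) (stress (g t) (f t)))
        - 4 * Real.pi * rho (g t) (f t) * g t a b) (Ici t₀) t
  /-- `R - k_ab k^ab + k² = 16π ρ` -/
  hamiltonian : ∀ t ∈ Ici t₀,
    scalarR C (g t) - (mixed (g t) (k t) * mixed (g t) (k t)).trace + trg (g t) (k t) ^ 2
      = 16 * Real.pi * rho (g t) (f t)
  /-- `∇^a k_ab = 8π j_b` -/
  momentum : ∀ t ∈ Ici t₀, ∀ b,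
    divg C (g t) (k t) b = 8 * Real.pi * current (g t) (f t) b
  /-- `∂_t f + (p^0)⁻¹ C^d_ba p^b p_d ∂f/∂p_a = 0` -/
  vlasov : ∀ t ∈ Ici t₀, ∀ p : Mom,
    HasDerivWithinAt (fun s => f s p)
      (-((energy (g t) p)⁻¹ * ∑ a, ∑ b, ∑ d,
        C d b a * raise (g t) p b * p d * fderiv ℝ (f t) p (Pi.single a 1))) (Ici t₀) t

/-! ### Cosmological variables -/

/-- The Hubble parameter `H = -k/3`. -/
def hubble (g k : Mat) : ℝ := -(1 / 3) * trg g k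

/-- The trace-free part `σ_ab = k_ab + H g_ab` of the second fundamental form. -/
def sigma (g k : Mat) : Mat := k + hubble g k • g

/-- `Shear g k i j = Σ^i_j = σ^i_j / H`. -/
def Shear (g k : Mat) : Mat := (hubble g k)⁻¹ • mixed g (sigma g k)

/-- `Σ_+ = -½ (Σ^2_2 + Σ^3_3)`. -/
def shearPlus (g k : Mat) : ℝ := -(1 / 2) * (Shear g k 1 1 + Shear g k 2 2)

/-- `Σ_- = -(2√3)⁻¹ (Σ^2_2 - Σ^3_3)`. -/
def shearMinus (g k : Mat) : ℝ :=
  -(1 / (2 * Real.sqrt 3)) * (Shear g k 1 1 - Shear g k 2 2)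

/-- The invariant size `(σ_ab σ^ab)^(1/2) / H = (Σ^a_b Σ^b_a)^(1/2)` of the shear. -/
def shearNorm (g k : Mat) : ℝ := Real.sqrt (Shear g k * Shear g k).trace

/-- `A = -R / (6 H²)` for Bianchi type V. -/
def varA (g k : Mat) : ℝ := -(scalarR structV g) / (6 * hubble g k ^ 2)

/-- `Ã = 1 - A`. -/
def varAtilde (g k : Mat) : ℝ := 1 - varA g k

/-- A Bianchi V solution on `[t₀, ∞)` which is expanding at `t₀`, with the origin of time chosen
such that `t₀ = -3 / k(t₀)`. -/
structure IsBianchiV (t₀ : ℝ) (g k : ℝ → Mat) (f : ℝ → Mom → ℝ) : Prop where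
  solution : IsSolution structV t₀ g k f
  expanding : trg (g t₀) (k t₀) < 0
  origin : t₀ = -3 / trg (g t₀) (k t₀)

/-- The data at a time are `δ`-small: `|Σ_±|`, `|Σ^i_j|` (`i ≠ j`), `|A - 1|` and `P` are less
than `δ`. -/
structure SmallData (δ : ℝ) (g k : Mat) (f : Mom → ℝ) : Prop where
  plus : |shearPlus g k| < δ
  minus : |shearMinus g k| < δ
  offDiag : ∀ i j, i ≠ j → |Shear g k i j| < δ
  curvature : |varA g k - 1| < δ
  momenta : supMom g f < δ

end

end Bianchi

/-! Everything is driven by one scalar, the deficit `y = 1 - a / H²` with `a = g^11`. Every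
left-invariant metric of type V has constant curvature `-g^11`, so `R_ab = -2 g^11 g_ab`: the
curvature enters only through `a`, it exerts no trace-free force on the shear, and `y` is exactly
`Ã`. The Hamiltonian constraint reads `y H² = w/6 + (8π/3) ρ`, where `w = σ_ab σ^ab`. Hence `y ≥ 0`,
and smallness of `y` bounds both the shear and the energy density relative to `H²`.

The momentum constraint gives `σ^11 = -(8π/3) j^1`. This removes the shear from the equation for
`a`, where it would contribute a term of order `√y` to `y'`. What remains is a damping of `y` plus a
current term, bounded by `P ρ` and thus absorbed when momenta are small: `y' ≤ -(3/4) H y`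
(`ShearFlow.deriv_deficit_le`). Conversely, while `y` is small, `√w` is below `H` and `|p|²`
decreases along Vlasov characteristics, since its logarithmic derivative is at most `-2 (H - √w)`
(`IsSolution.normSq_lt_of_ne_zero`). These two facts close a continuity argument
(`IsBianchiV.deficit_le_init`), which already gives stability.

For the rates, `(1/H)' = 1 + O(y)` with `1/H = t` initially gives `t H` close to `1`, so `y =
O(t^(-1/2))`, `1 - t H = O(t^(-1/2))`, `√w = O(t^(-5/4))` and `P² = O(t^(-7/4))`. Every error
coefficient is then `O(t^(-5/4))`, hence integrable, and a Gronwall argument recovers the sharp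
bound `w / H² = O(t^(-4))` (`ShearFlow.exists_shear_bound`). The same argument gives `g^ii =
O(t^(-2))` and `g_jj = O(t²)`, which turns the invariant bound on the shear into one for its
components in the fixed frame (`IsBianchiV.exists_shear_decay`). -/

namespace Bianchi

noncomputable section

/-! ### Linear algebra of the metric inner product -/

open scoped MatrixOrder Matrix.Norms.L2Operator in
theorem trace_sq_nonneg {G X : Mat} (hG : G.PosSemidef) (hX : X.IsSymm) :
    0 ≤ (G * X * (G * X)).trace := by
  -- With `G = BᵀB` the trace becomes the squared Frobenius norm of the symmetric matrix `B X Bᵀ`.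
  obtain ⟨B, rfl⟩ := CStarAlgebra.nonneg_iff_eq_star_mul_self.mp hG.nonneg
  rw [Matrix.star_eq_conjTranspose, Matrix.conjTranspose_eq_transpose_of_trivial]
  have h1 : (B.transpose * B * X * (B.transpose * B * X)).trace
      = ((B * X * B.transpose) * (B * X * B.transpose).transpose).trace := by
    have : (B * X * B.transpose).transpose = B * X * B.transpose := by
      rw [Matrix.transpose_mul, Matrix.transpose_mul, Matrix.transpose_transpose, hX.eq,
        Matrix.mul_assoc]
    rw [this, Matrix.trace_mul_comm (B * X * B.transpose)]
    simp only [Matrix.mul_assoc]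
    rw [Matrix.trace_mul_comm B.transpose]
    simp only [Matrix.mul_assoc]
  rw [h1]
  simp only [Matrix.trace, Matrix.diag, Matrix.mul_apply (M := B * X * B.transpose),
    Matrix.transpose_apply]
  exact Finset.sum_nonneg fun i _ => Finset.sum_nonneg fun j _ => mul_self_nonneg _

/-- The quadratic form `M^ab p_a p_b`. -/
def quad (M : Mat) (p : Mom) : ℝ := ∑ a, ∑ b, M a b * p a * p b

theorem normSq_eq_quad (g : Mat) (p : Mom) : normSq g p = quad g⁻¹ p := rfl

theorem quad_eq (M : Mat) (p : Mom) : quad M p = p ⬝ᵥ M.mulVec p := by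
  simp only [quad, dotProduct, Matrix.mulVec, Finset.mul_sum]
  exact Finset.sum_congr rfl fun i _ => Finset.sum_congr rfl fun j _ => by ring

theorem quad_nonneg {G : Mat} (hG : G.PosDef) (p : Mom) : 0 ≤ quad G p := by
  rw [quad_eq]
  simpa using hG.posSemidef.dotProduct_mulVec_nonneg p

theorem sq_le_of_forall_quadratic {w q n : ℝ} (h : ∀ s : ℝ, 0 ≤ w + 2 * s * q + s ^ 2 * n ^ 2) :
    q ^ 2 ≤ w * n ^ 2 := by
  have := discrim_le_zero (a := n ^ 2) (b := 2 * q) (c := w) (fun s => by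
    have := h s; nlinarith)
  rw [discrim] at this
  nlinarith

/-- Cauchy–Schwarz for the form `tr (G X G Y)` on symmetric matrices, with `Y = p ⊗ p`: the trace of
the square of `G (X + s p ⊗ p)` is nonnegative for every `s`, so its discriminant is nonpositive. -/
theorem quad_sq_le {G X : Mat} (hG : G.PosDef) (hX : X.IsSymm) (p : Mom) :
    quad (G * X * G) p ^ 2 ≤ (G * X * (G * X)).trace * quad G p ^ 2 := by
  apply sq_le_of_forall_quadratic
  intro s
  have hY : (X + s • Matrix.vecMulVec p p).IsSymm := by
    refine hX.add (Matrix.IsSymm.smul ?_ s)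
    ext i j
    simp [Matrix.vecMulVec_apply, mul_comm]
  have h := trace_sq_nonneg hG.posSemidef hY
  convert h using 1
  have e1 : (G * X * (G * Matrix.vecMulVec p p)).trace = quad (G * X * G) p := by
    rw [← Matrix.mul_assoc, Matrix.mul_vecMulVec, Matrix.trace_vecMulVec, quad_eq, dotProduct_comm]
  have e2 : (G * Matrix.vecMulVec p p * (G * X)).trace = quad (G * X * G) p := by
    rw [Matrix.trace_mul_comm, e1]
  have e3 : (G * Matrix.vecMulVec p p * (G * Matrix.vecMulVec p p)).trace = quad G p ^ 2 := by
    rw [← Matrix.mul_assoc, Matrix.mul_vecMulVec, Matrix.mul_vecMulVec, Matrix.trace_vecMulVec,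
      ← Matrix.mulVec_mulVec, Matrix.vecMulVec_mulVec, quad_eq]
    simp only [op_smul_eq_smul, smul_dotProduct, smul_eq_mul]
    rw [dotProduct_comm p]
    ring
  simp only [Matrix.mul_add, Matrix.add_mul, Matrix.mul_smul, Matrix.smul_mul, Matrix.trace_add,
    Matrix.trace_smul, smul_eq_mul, e1, e2, e3]
  ring

theorem abs_quad_le {G X : Mat} (hG : G.PosDef) (hX : X.IsSymm) (p : Mom) :
    |quad (G * X * G) p| ≤ √(G * X * (G * X)).trace * quad G p := by
  have h0 := trace_sq_nonneg hG.posSemidef hX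
  refine abs_le_of_sq_le_sq ?_ (mul_nonneg (Real.sqrt_nonneg _) (quad_nonneg hG p))
  rw [mul_pow, Real.sq_sqrt h0]
  exact quad_sq_le hG hX p

theorem bilin_sq_le {G : Mat} (hG : G.PosDef) (p q : Mom) :
    (q ⬝ᵥ G.mulVec p) ^ 2 ≤ quad G q * quad G p := by
  have hGs : G.transpose = G := by
    simpa [Matrix.IsHermitian, Matrix.conjTranspose_eq_transpose_of_trivial]
      using hG.isHermitian
  have hc : p ⬝ᵥ G.mulVec q = q ⬝ᵥ G.mulVec p := by
    rw [Matrix.dotProduct_mulVec, ← Matrix.mulVec_transpose, hGs, dotProduct_comm]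
  have := discrim_le_zero (a := quad G p) (b := 2 * (q ⬝ᵥ G.mulVec p)) (c := quad G q) (fun s => by
    have h := quad_nonneg hG (q + s • p)
    rw [quad_eq] at h
    simp only [Matrix.mulVec_add, Matrix.mulVec_smul, add_dotProduct, dotProduct_add,
      smul_dotProduct, dotProduct_smul, smul_eq_mul, hc, ← quad_eq] at h
    linarith)
  rw [discrim] at this
  nlinarith

/-! ### Curvature and divergence for Bianchi type V -/

theorem isSymm_of_posDef {g : Mat} (hg : g.PosDef) : g.IsSymm := by
  simpa [Matrix.IsHermitian, Matrix.IsSymm, Matrix.conjTranspose_eq_transpose_of_trivial]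
    using hg.isHermitian

theorem inv_mul_of_posDef {g : Mat} (hg : g.PosDef) : g⁻¹ * g = 1 :=
  Matrix.nonsing_inv_mul g ((Matrix.isUnit_iff_isUnit_det _).mp hg.isUnit)

theorem mul_inv_of_posDef {g : Mat} (hg : g.PosDef) : g * g⁻¹ = 1 :=
  Matrix.mul_nonsing_inv g ((Matrix.isUnit_iff_isUnit_det _).mp hg.isUnit)

theorem connLow_structV {g : Mat} (hg : g.IsSymm) (a b c : Fin 3) :
    connLow structV g a b c = (if a = 0 then g b c else 0) - (if b = 0 then g a c else 0) := by
  have h01 := hg.apply 0 1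
  have h02 := hg.apply 0 2
  have h12 := hg.apply 1 2
  fin_cases a <;> fin_cases b <;> fin_cases c <;>
    simp [connLow, structV, Fin.sum_univ_three] <;> linarith

theorem conn_structV {g : Mat} (hg : g.PosDef) (d b c : Fin 3) :
    conn structV g d b c = g⁻¹ d 0 * g b c - (if b = 0 then (1 : Mat) d c else 0) := by
  have h : ∑ a, g⁻¹ d a * g a c = (1 : Mat) d c := by
    rw [← inv_mul_of_posDef hg, Matrix.mul_apply]
  simp only [conn, connLow_structV (isSymm_of_posDef hg), mul_sub, Finset.sum_sub_distrib]
  congr 1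
  · simp
  · split_ifs
    · exact h
    · simp

/-- The type V group with any left-invariant metric is a space of constant curvature `-g^11`. -/
theorem ricci_structV {g : Mat} (hg : g.PosDef) (b c : Fin 3) :
    ricci structV g b c = -2 * g⁻¹ 0 0 * g b c := by
  have hgs := isSymm_of_posDef hg
  have hG : ∀ c, ∑ a, g⁻¹ a 0 * g a c = if c = 0 then 1 else 0 := by
    intro c
    have := congrFun (congrFun (mul_inv_of_posDef hg) c) 0
    rw [Matrix.mul_apply, Matrix.one_apply] at this
    rw [← this]
    exact Finset.sum_congr rfl fun a _ => by rw [← hgs.apply a c, mul_comm]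
  have h01 := hgs.apply 0 1
  have h02 := hgs.apply 0 2
  have h12 := hgs.apply 1 2
  have R0 : g⁻¹ 0 0 * g 0 0 + g⁻¹ 1 0 * g 0 1 + g⁻¹ 2 0 * g 0 2 = 1 := by
    simpa [Fin.sum_univ_three, h01, h02, h12] using hG 0
  have R1 : g⁻¹ 0 0 * g 0 1 + g⁻¹ 1 0 * g 1 1 + g⁻¹ 2 0 * g 1 2 = 0 := by
    simpa [Fin.sum_univ_three, h01, h02, h12] using hG 1
  have R2 : g⁻¹ 0 0 * g 0 2 + g⁻¹ 1 0 * g 1 2 + g⁻¹ 2 0 * g 2 2 = 0 := by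
    simpa [Fin.sum_univ_three, h01, h02, h12] using hG 2
  simp only [ricci, conn_structV hg]
  -- `R0`, `R1`, `R2` say that the first column of `g⁻¹` is dual to `g`; each Ricci component
  -- reduces to a combination of these relations.
  fin_cases b <;> fin_cases c <;>
    simp [structV, Fin.sum_univ_three, h01, h02, h12, Matrix.one_apply]
  · linear_combination g 0 0 * (g⁻¹ 0 0 * R0 + g⁻¹ 1 0 * R1 + g⁻¹ 2 0 * R2)
      - (g⁻¹ 0 0 * g 0 0 + g⁻¹ 1 0 * g 0 1 + g⁻¹ 2 0 * g 0 2) * R0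
  · linear_combination g 0 1 * (g⁻¹ 0 0 * R0 + g⁻¹ 1 0 * R1 + g⁻¹ 2 0 * R2)
      - (g⁻¹ 0 0 * g 0 0 + g⁻¹ 1 0 * g 0 1 + g⁻¹ 2 0 * g 0 2) * R1
  · linear_combination g 0 2 * (g⁻¹ 0 0 * R0 + g⁻¹ 1 0 * R1 + g⁻¹ 2 0 * R2)
      - (g⁻¹ 0 0 * g 0 0 + g⁻¹ 1 0 * g 0 1 + g⁻¹ 2 0 * g 0 2) * R2
  · linear_combination g 0 1 * (g⁻¹ 0 0 * R0 + g⁻¹ 1 0 * R1 + g⁻¹ 2 0 * R2)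
      - (g⁻¹ 0 0 * g 0 1 + g⁻¹ 1 0 * g 1 1 + g⁻¹ 2 0 * g 1 2) * R0
  · linear_combination g 1 1 * (g⁻¹ 0 0 * R0 + g⁻¹ 1 0 * R1 + g⁻¹ 2 0 * R2)
      - (g⁻¹ 0 0 * g 0 1 + g⁻¹ 1 0 * g 1 1 + g⁻¹ 2 0 * g 1 2) * R1
  · linear_combination g 1 2 * (g⁻¹ 0 0 * R0 + g⁻¹ 1 0 * R1 + g⁻¹ 2 0 * R2)
      - (g⁻¹ 0 0 * g 0 1 + g⁻¹ 1 0 * g 1 1 + g⁻¹ 2 0 * g 1 2) * R2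
  · linear_combination g 0 2 * (g⁻¹ 0 0 * R0 + g⁻¹ 1 0 * R1 + g⁻¹ 2 0 * R2)
      - (g⁻¹ 0 0 * g 0 2 + g⁻¹ 1 0 * g 1 2 + g⁻¹ 2 0 * g 2 2) * R0
  · linear_combination g 1 2 * (g⁻¹ 0 0 * R0 + g⁻¹ 1 0 * R1 + g⁻¹ 2 0 * R2)
      - (g⁻¹ 0 0 * g 0 2 + g⁻¹ 1 0 * g 1 2 + g⁻¹ 2 0 * g 2 2) * R1
  · linear_combination g 2 2 * (g⁻¹ 0 0 * R0 + g⁻¹ 1 0 * R1 + g⁻¹ 2 0 * R2)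
      - (g⁻¹ 0 0 * g 0 2 + g⁻¹ 1 0 * g 1 2 + g⁻¹ 2 0 * g 2 2) * R2

theorem scalarR_structV {g : Mat} (hg : g.PosDef) : scalarR structV g = -6 * g⁻¹ 0 0 := by
  have h : ricci structV g = (-2 * g⁻¹ 0 0) • g := by
    ext b c
    simp [ricci_structV hg]
  have h2 : trg g g = (g⁻¹ * g).trace := by
    simp only [trg, Matrix.trace, Matrix.diag, Matrix.mul_apply]
    exact Finset.sum_congr rfl fun a _ => Finset.sum_congr rfl fun b _ => by
      rw [(isSymm_of_posDef hg).apply]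
  have h3 : trg g ((-2 * g⁻¹ 0 0) • g) = -2 * g⁻¹ 0 0 * trg g g := by
    simp only [trg, Matrix.smul_apply, smul_eq_mul, Finset.mul_sum]
    exact Finset.sum_congr rfl fun a _ => Finset.sum_congr rfl fun b _ => by ring
  rw [scalarR, h, h3, h2, inv_mul_of_posDef hg]
  simp
  ring

theorem trg_eq_trace (g : Mat) {h : Mat} (hh : h.IsSymm) : trg g h = (g⁻¹ * h).trace := by
  simp only [trg, Matrix.trace, Matrix.diag, Matrix.mul_apply]
  exact Finset.sum_congr rfl fun a _ => Finset.sum_congr rfl fun b _ => by rw [hh.apply]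

theorem isSymm_inv {g : Mat} (hg : g.PosDef) : (g⁻¹).IsSymm := isSymm_of_posDef hg.inv

theorem divg_structV {g h : Mat} (hg : g.PosDef) (hh : h.IsSymm) (b : Fin 3) :
    divg structV g h b = -3 * (g⁻¹ * h) 0 b + if b = 0 then trg g h else 0 := by
  have hgs := isSymm_of_posDef hg
  have hGs := isSymm_inv hg
  have e : ∀ a b, ∑ c, g⁻¹ a c * g b c = (1 : Mat) a b := fun a b => by
    rw [← inv_mul_of_posDef hg, Matrix.mul_apply]
    exact Finset.sum_congr rfl fun c _ => by rw [hgs.apply]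
  have T : ∑ a, ∑ c, g⁻¹ a c * g a c = 3 := by simp [e]
  have E0 := e 0 b
  have E1 := e 1 b
  have E2 := e 2 b
  fin_cases b <;>
  · simp [Fin.sum_univ_three, hgs.apply 0 1, hgs.apply 0 2, hgs.apply 1 2, hGs.apply 0 1,
      hGs.apply 0 2, hGs.apply 1 2, Matrix.one_apply] at T E0 E1 E2
    simp [divg, trg, conn_structV hg, Matrix.mul_apply, Fin.sum_univ_three, Matrix.one_apply,
      hgs.apply 0 1, hgs.apply 0 2, hgs.apply 1 2, hGs.apply 0 1,
      hGs.apply 0 2, hGs.apply 1 2, hh.apply 0 1, hh.apply 0 2, hh.apply 1 2]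
    generalize g⁻¹ = G at *
    first
    | linear_combination
        -(G 0 0 * h 0 0 + G 0 1 * h 0 1 + G 0 2 * h 0 2) * T
        - (G 0 0 * h 0 0 + G 0 1 * h 0 1 + G 0 2 * h 0 2) * E0
        - (G 0 0 * h 0 1 + G 0 1 * h 1 1 + G 0 2 * h 1 2) * E1
        - (G 0 0 * h 0 2 + G 0 1 * h 1 2 + G 0 2 * h 2 2) * E2
    | linear_combination
        -(G 0 0 * h 0 1 + G 0 1 * h 1 1 + G 0 2 * h 1 2) * T
        - (G 0 0 * h 0 0 + G 0 1 * h 0 1 + G 0 2 * h 0 2) * E0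
        - (G 0 0 * h 0 1 + G 0 1 * h 1 1 + G 0 2 * h 1 2) * E1
        - (G 0 0 * h 0 2 + G 0 1 * h 1 2 + G 0 2 * h 2 2) * E2
    | linear_combination
        -(G 0 0 * h 0 2 + G 0 1 * h 1 2 + G 0 2 * h 2 2) * T
        - (G 0 0 * h 0 0 + G 0 1 * h 0 1 + G 0 2 * h 0 2) * E0
        - (G 0 0 * h 0 1 + G 0 1 * h 1 1 + G 0 2 * h 1 2) * E1
        - (G 0 0 * h 0 2 + G 0 1 * h 1 2 + G 0 2 * h 2 2) * E2

/-! ### Moments of the distribution function -/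

theorem continuous_quad (M : Mat) : Continuous (quad M) := by
  unfold quad
  fun_prop

theorem continuous_normSq (g : Mat) : Continuous (normSq g) := continuous_quad g⁻¹

theorem normSq_nonneg {g : Mat} (hg : g.PosDef) (p : Mom) : 0 ≤ normSq g p :=
  quad_nonneg hg.inv p

theorem continuous_energy (g : Mat) : Continuous (energy g) := by
  unfold energy
  have := continuous_normSq g
  fun_prop

theorem one_le_energy {g : Mat} (hg : g.PosDef) (p : Mom) : 1 ≤ energy g p :=
  Real.one_le_sqrt.mpr (by linarith [normSq_nonneg hg p])

theorem energy_sq {g : Mat} (hg : g.PosDef) (p : Mom) : energy g p ^ 2 = 1 + normSq g p :=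
  Real.sq_sqrt (by linarith [normSq_nonneg hg p])

variable {g : Mat} {f : Mom → ℝ}

theorem integrable_mul (hf : Continuous f) (hc : HasCompactSupport f) {u : Mom → ℝ}
    (hu : Continuous u) : Integrable fun p => f p * u p :=
  (hf.mul hu).integrable_of_hasCompactSupport hc.mul_right

theorem momInt_mul_le (hf : Continuous f) (hc : HasCompactSupport f) (h0 : ∀ p, 0 ≤ f p)
    {u v : Mom → ℝ} (hu : Continuous u) (hv : Continuous v)
    (huv : ∀ p, f p ≠ 0 → u p ≤ v p) :
    momInt g (fun p => f p * u p) ≤ momInt g (fun p => f p * v p) := by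
  refine mul_le_mul_of_nonneg_left ?_ (by positivity)
  refine integral_mono (integrable_mul hf hc hu) (integrable_mul hf hc hv) fun p => ?_
  by_cases hp : f p = 0
  · simp [hp]
  · exact mul_le_mul_of_nonneg_left (huv p hp) (h0 p)

theorem momInt_const_mul (c : ℝ) (u : Mom → ℝ) :
    momInt g (fun p => f p * (c * u p)) = c * momInt g (fun p => f p * u p) := by
  have : (fun p => f p * (c * u p)) = fun p => c * (f p * u p) := by
    ext p
    ring
  rw [momInt, this, integral_const_mul, momInt]
  ring

theorem abs_momInt_mul_le (hf : Continuous f) (hc : HasCompactSupport f) (h0 : ∀ p, 0 ≤ f p)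
    {u v : Mom → ℝ} (hu : Continuous u) (hv : Continuous v)
    (huv : ∀ p, f p ≠ 0 → |u p| ≤ v p) :
    |momInt g (fun p => f p * u p)| ≤ momInt g (fun p => f p * v p) := by
  rw [abs_le]
  constructor
  · have h := momInt_mul_le (g := g) hf hc h0 (u := fun p => (-1) * v p) (by fun_prop) hu
      fun p hp => by linarith [neg_le_of_abs_le (huv p hp)]
    rw [momInt_const_mul] at h
    linarith
  · exact momInt_mul_le hf hc h0 hu hv fun p hp => le_of_abs_le (huv p hp)

theorem continuous_div_energy (hg : g.PosDef) {u : Mom → ℝ} (hu : Continuous u) :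
    Continuous fun p => u p / energy g p :=
  hu.div (continuous_energy g) fun p => by linarith [one_le_energy hg p]

theorem sum_mul_stress (hg : g.PosDef) (hf : Continuous f) (hc : HasCompactSupport f) (M : Mat) :
    ∑ a, ∑ b, M a b * stress g f a b = momInt g (fun p => f p * (quad M p / energy g p)) := by
  have hi : ∀ a b, Integrable fun p : Mom => M a b * (f p * (p a * p b / energy g p)) :=
    fun a b => (integrable_mul hf hc (continuous_div_energy hg (by fun_prop))).const_mul _
  have h1 : (fun p => f p * (quad M p / energy g p))
      = fun p => ∑ a, ∑ b, M a b * (f p * (p a * p b / energy g p)) := by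
    ext p
    simp only [quad, Finset.sum_div, Finset.mul_sum]
    exact Finset.sum_congr rfl fun a _ => Finset.sum_congr rfl fun b _ => by ring
  rw [momInt, h1, integral_finsetSum _ fun a _ => integrable_finsetSum _ fun b _ => hi a b,
    Finset.mul_sum]
  refine Finset.sum_congr rfl fun a _ => ?_
  rw [integral_finsetSum _ fun b _ => hi a b, Finset.mul_sum]
  refine Finset.sum_congr rfl fun b _ => ?_
  rw [integral_const_mul, stress, momInt]
  have : (fun p => f p * p a * p b / energy g p) = fun p => f p * (p a * p b / energy g p) := by
    ext p
    ring
  rw [this]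
  ring

theorem trg_stress (hg : g.PosDef) (hf : Continuous f) (hc : HasCompactSupport f) :
    trg g (stress g f) = momInt g (fun p => f p * (normSq g p / energy g p)) :=
  sum_mul_stress hg hf hc g⁻¹

theorem stress_isSymm (g : Mat) (f : Mom → ℝ) : (stress g f).IsSymm := by
  ext a b
  simp only [Matrix.transpose_apply, stress]
  congr 1
  ext p
  ring

theorem trg_stress_nonneg (hg : g.PosDef) (hf : Continuous f) (hc : HasCompactSupport f)
    (h0 : ∀ p, 0 ≤ f p) : 0 ≤ trg g (stress g f) := by
  rw [trg_stress hg hf hc]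
  refine mul_nonneg (by positivity) (integral_nonneg fun p => mul_nonneg (h0 p) ?_)
  exact div_nonneg (normSq_nonneg hg p) (by linarith [one_le_energy hg p])

theorem trg_stress_le_rho (hg : g.PosDef) (hf : Continuous f) (hc : HasCompactSupport f)
    (h0 : ∀ p, 0 ≤ f p) : trg g (stress g f) ≤ rho g f := by
  rw [trg_stress hg hf hc]
  refine momInt_mul_le hf hc h0 (continuous_div_energy hg (continuous_normSq g))
    (continuous_energy g) fun p _ => ?_
  have := one_le_energy hg p
  rw [div_le_iff₀ (by linarith), ← sq, energy_sq hg]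
  linarith

/-- Slow particles behave like dust: once the momenta decay, the pressure is of lower order than the
energy density. -/
theorem trg_stress_le_mul_rho (hg : g.PosDef) (hf : Continuous f) (hc : HasCompactSupport f)
    (h0 : ∀ p, 0 ≤ f p) {B : ℝ} (hB : ∀ p, f p ≠ 0 → normSq g p ≤ B) :
    trg g (stress g f) ≤ B * rho g f := by
  have hE := continuous_energy g
  rw [trg_stress hg hf hc, rho, ← momInt_const_mul]
  refine momInt_mul_le hf hc h0 (continuous_div_energy hg (continuous_normSq g))
    (by fun_prop) fun p hp => ?_
  have := one_le_energy hg p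
  have hn := normSq_nonneg hg p
  have hBp := hB p hp
  rw [div_le_iff₀ (by linarith), mul_assoc, ← sq, energy_sq hg]
  nlinarith

theorem abs_sum_mul_stress_le (hg : g.PosDef) (hf : Continuous f) (hc : HasCompactSupport f)
    (h0 : ∀ p, 0 ≤ f p) {X : Mat} (hX : X.IsSymm) :
    |∑ a, ∑ b, (g⁻¹ * X * g⁻¹) a b * stress g f a b|
      ≤ √(g⁻¹ * X * (g⁻¹ * X)).trace * trg g (stress g f) := by
  have hc1 := continuous_div_energy hg (continuous_normSq g)
  rw [sum_mul_stress hg hf hc, trg_stress hg hf hc, ← momInt_const_mul]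
  refine abs_momInt_mul_le hf hc h0 (continuous_div_energy hg (continuous_quad _))
    (by fun_prop) fun p _ => ?_
  have h1 := one_le_energy hg p
  rw [abs_div, abs_of_pos (a := energy g p) (by linarith), ← mul_div_assoc]
  exact div_le_div_of_nonneg_right (abs_quad_le hg.inv hX p) (by linarith)

theorem raise_sq_le (hg : g.PosDef) (p : Mom) (a : Fin 3) :
    raise g p a ^ 2 ≤ g⁻¹ a a * normSq g p := by
  have h := bilin_sq_le hg.inv p (Pi.single a 1)
  have e1 : quad g⁻¹ (Pi.single a 1) = g⁻¹ a a := by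
    simp [quad_eq]
  have e2 : (Pi.single a 1 : Mom) ⬝ᵥ g⁻¹.mulVec p = raise g p a := by
    rw [single_one_dotProduct]
    rfl
  rwa [e1, e2] at h

/-- Pointwise `|p^a| ≤ √(g^aa) |p|`. The factor `√(g^aa)` matters: for the first component it is at
most `H`, by the Hamiltonian constraint. -/
theorem abs_sum_mul_current_le (hg : g.PosDef) (hf : Continuous f) (hc : HasCompactSupport f)
    (h0 : ∀ p, 0 ≤ f p) {B : ℝ} (hB : ∀ p, f p ≠ 0 → normSq g p ≤ B) (a : Fin 3) :
    |∑ b, g⁻¹ a b * current g f b| ≤ √(g⁻¹ a a * B) * rho g f := by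
  have hE := continuous_energy g
  have h1 : ∑ b, g⁻¹ a b * current g f b = momInt g (fun p => f p * raise g p a) := by
    have hi : ∀ b, Integrable fun p : Mom => g⁻¹ a b * (f p * p b) :=
      fun b => (integrable_mul hf hc (by fun_prop)).const_mul _
    have h2 : (fun p => f p * raise g p a) = fun p => ∑ b, g⁻¹ a b * (f p * p b) := by
      ext p
      simp only [raise, Finset.mul_sum]
      exact Finset.sum_congr rfl fun b _ => by ring
    rw [momInt, h2, integral_finsetSum _ fun b _ => hi b, Finset.mul_sum]
    refine Finset.sum_congr rfl fun b _ => ?_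
    rw [integral_const_mul, current, momInt]
    ring
  rw [h1, rho, ← momInt_const_mul]
  refine abs_momInt_mul_le hf hc h0 (by unfold raise; fun_prop) (by fun_prop) fun p hp => ?_
  have hE1 := one_le_energy hg p
  have hG : 0 < g⁻¹ a a := hg.inv.diag_pos
  have h3 : |raise g p a| ≤ √(g⁻¹ a a * B) := by
    refine Real.abs_le_sqrt ((raise_sq_le hg p a).trans ?_)
    exact mul_le_mul_of_nonneg_left (hB p hp) hG.le
  nlinarith [Real.sqrt_nonneg (g⁻¹ a a * B)]

theorem supMom_le {B : ℝ} (hB : ∀ p, f p ≠ 0 → normSq g p ≤ B) : supMom g f ≤ √B := by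
  refine Real.sSup_le ?_ (Real.sqrt_nonneg _)
  rintro x ⟨p, hp, rfl⟩
  exact Real.sqrt_le_sqrt (hB p hp)

theorem supMom_nonneg : 0 ≤ supMom g f := by
  refine Real.sSup_nonneg ?_
  rintro x ⟨p, hp, rfl⟩
  exact Real.sqrt_nonneg _

theorem sqrt_normSq_le_supMom (hc : HasCompactSupport f) {p : Mom} (hp : f p ≠ 0) :
    √(normSq g p) ≤ supMom g f := by
  refine le_csSup ?_ ⟨p, hp, rfl⟩
  have h := (hc.isCompact.image_of_continuousOn
    (f := fun p => √(normSq g p)) (continuous_normSq g).sqrt.continuousOn).bddAbove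
  refine h.mono ?_
  rintro x ⟨q, hq, rfl⟩
  exact ⟨q, subset_tsupport _ hq, rfl⟩

/-! ### Evolution of the geometric scalars -/

open scoped Matrix.Norms.Operator in
theorem hasDerivWithinAt_inv_apply {g : ℝ → Mat} {g' : Mat} {s : Set ℝ} {t : ℝ}
    (hg : ∀ a b, HasDerivWithinAt (fun x => g x a b) (g' a b) s t) (ht : IsUnit (g t))
    (a b : Fin 3) :
    HasDerivWithinAt (fun x => (g x)⁻¹ a b) (-((g t)⁻¹ * g' * (g t)⁻¹) a b) s t := by
  have h1 : HasDerivWithinAt g g' s t := by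
    have e : g = fun x => ∑ i, ∑ j, g x i j • (Matrix.single i j (1 : ℝ) : Mat) := by
      ext x : 1
      conv_lhs => rw [Matrix.matrix_eq_sum_single (g x)]
      simp
    have e' : g' = ∑ i, ∑ j, g' i j • (Matrix.single i j (1 : ℝ) : Mat) := by
      conv_lhs => rw [Matrix.matrix_eq_sum_single g']
      simp
    rw [e, e']
    exact HasDerivWithinAt.fun_sum fun i _ => HasDerivWithinAt.fun_sum fun j _ =>
      (hg i j).smul_const _
  obtain ⟨u, hu⟩ := ht
  have h2 := hasFDerivAt_ringInverse (𝕜 := ℝ) u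
  rw [hu] at h2
  have h3 := h2.comp_hasDerivWithinAt t h1
  let φ : Mat →L[ℝ] ℝ := LinearMap.toContinuousLinearMap
    (Matrix.entryLinearMap ℝ ℝ a b)
  have h4 := φ.hasFDerivAt.comp_hasDerivWithinAt t h3
  have e5 : ((u⁻¹ : Matˣ) : Mat) = (g t)⁻¹ := by
    rw [← hu, Matrix.coe_units_inv]
  have e6 : (fun x => (g x)⁻¹ a b) = φ ∘ Ring.inverse ∘ g := by
    funext x
    change (g x)⁻¹ a b = (Ring.inverse (g x)) a b
    rw [Matrix.nonsing_inv_eq_ringInverse]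
  have e7 : -((g t)⁻¹ * g' * (g t)⁻¹) a b
      = φ ((-ContinuousLinearMap.mulLeftRight ℝ Mat ↑u⁻¹ ↑u⁻¹) g') := by
    change _ = ((-ContinuousLinearMap.mulLeftRight ℝ Mat ↑u⁻¹ ↑u⁻¹) g') a b
    rw [neg_apply, ContinuousLinearMap.mulLeftRight_apply, e5]
    rfl
  rw [e6, e7]
  exact h4

theorem hasDerivWithinAt_mul_apply {A B : ℝ → Mat} {A' B' : Mat} {s : Set ℝ} {t : ℝ}
    (hA : ∀ a b, HasDerivWithinAt (fun x => A x a b) (A' a b) s t)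
    (hB : ∀ a b, HasDerivWithinAt (fun x => B x a b) (B' a b) s t) (a b : Fin 3) :
    HasDerivWithinAt (fun x => (A x * B x) a b) ((A' * B t + A t * B') a b) s t := by
  simp only [Matrix.mul_apply, Matrix.add_apply, ← Finset.sum_add_distrib]
  exact HasDerivWithinAt.fun_sum fun c _ => (hA a c).mul (hB c b)

theorem hasDerivWithinAt_trace {A : ℝ → Mat} {A' : Mat} {s : Set ℝ} {t : ℝ}
    (hA : ∀ a b, HasDerivWithinAt (fun x => A x a b) (A' a b) s t) :
    HasDerivWithinAt (fun x => (A x).trace) A'.trace s t :=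
  HasDerivWithinAt.fun_sum fun c _ => hA c c

/-- The squared shear `σ_ab σ^ab`. -/
def shearSq (g k : Mat) : ℝ := (g⁻¹ * sigma g k * (g⁻¹ * sigma g k)).trace

/-- The contraction `σ^ab S_ab`. -/
def shearStress (g k : Mat) (f : Mom → ℝ) : ℝ :=
  ∑ a, ∑ b, (g⁻¹ * sigma g k * g⁻¹) a b * stress g f a b

/-- The component `j^1` of the matter current. -/
def currentUp (g : Mat) (f : Mom → ℝ) : ℝ := ∑ b, g⁻¹ 0 b * current g f b

theorem inv_mul_sigma {g : Mat} (hg : g.PosDef) (k : Mat) :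
    g⁻¹ * sigma g k = g⁻¹ * k + hubble g k • (1 : Mat) := by
  rw [sigma, Matrix.mul_add, Matrix.mul_smul, inv_mul_of_posDef hg]

theorem sigma_isSymm {g k : Mat} (hg : g.PosDef) (hk : k.IsSymm) : (sigma g k).IsSymm :=
  hk.add ((isSymm_of_posDef hg).smul _)

theorem trace_inv_mul {g k : Mat} (hk : k.IsSymm) : (g⁻¹ * k).trace = -3 * hubble g k := by
  rw [hubble, trg_eq_trace g hk]
  ring

theorem shearSq_eq {g k : Mat} (hg : g.PosDef) (hk : k.IsSymm) :
    shearSq g k = (g⁻¹ * k * (g⁻¹ * k)).trace - 3 * hubble g k ^ 2 := by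
  rw [shearSq, inv_mul_sigma hg]
  simp only [Matrix.mul_add, Matrix.add_mul, Matrix.trace_add, Matrix.smul_mul, Matrix.mul_smul,
    Matrix.trace_smul, Matrix.mul_one, Matrix.one_mul, Matrix.trace_one, trace_inv_mul hk]
  simp
  ring

theorem trace_mul_eq_sum {A S : Mat} (hS : S.IsSymm) :
    (A * S).trace = ∑ a, ∑ b, A a b * S a b := by
  simp only [Matrix.trace, Matrix.diag, Matrix.mul_apply]
  exact Finset.sum_congr rfl fun a _ => Finset.sum_congr rfl fun b _ => by rw [hS.apply]

theorem shearStress_eq {g : Mat} (hg : g.PosDef) (k : Mat) (f : Mom → ℝ) :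
    shearStress g k f
      = (g⁻¹ * k * (g⁻¹ * stress g f)).trace + hubble g k * trg g (stress g f) := by
  rw [shearStress, ← trace_mul_eq_sum (stress_isSymm g f), inv_mul_sigma hg,
    trg_eq_trace g (stress_isSymm g f)]
  simp only [Matrix.add_mul, Matrix.smul_mul, Matrix.one_mul, Matrix.trace_add, Matrix.trace_smul,
    Matrix.mul_assoc, smul_eq_mul]

namespace IsSolution

variable {t₀ : ℝ} {g k : ℝ → Mat} {f : ℝ → Mom → ℝ}

/-- Symmetry passes from `g` to `k` through `ġ = -2k` and uniqueness of one-sided derivatives. -/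
theorem k_isSymm (hs : IsSolution structV t₀ g k f) {t : ℝ} (ht : t ∈ Ici t₀) :
    (k t).IsSymm := by
  ext a b
  have h1 := hs.metric_eq t ht a b
  have h2 := (hs.metric_eq t ht b a).congr (f₁ := fun s => g s a b)
    (fun s hs' => ((isSymm_of_posDef (hs.posDef s hs')).apply a b).symm)
    ((isSymm_of_posDef (hs.posDef t ht)).apply a b).symm
  have := (uniqueDiffOn_Ici t₀ t ht).eq_deriv _ h1 h2
  rw [Matrix.transpose_apply]
  linarith

theorem continuous_f (hs : IsSolution structV t₀ g k f) {t : ℝ} (ht : t ∈ Ici t₀) :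
    Continuous (f t) := by
  have h := hs.smooth_f.continuousOn
  rw [← continuousOn_univ]
  exact h.comp (f := fun p => (t, p)) (by fun_prop) fun p _ => ⟨ht, mem_univ _⟩

theorem hasDerivWithinAt_inv (hs : IsSolution structV t₀ g k f) {t : ℝ} (ht : t ∈ Ici t₀)
    (a b : Fin 3) :
    HasDerivWithinAt (fun s => (g s)⁻¹ a b) ((2 • ((g t)⁻¹ * k t * (g t)⁻¹)) a b) (Ici t₀) t := by
  have h := hasDerivWithinAt_inv_apply (g' := (-2 : ℝ) • k t) (s := Ici t₀) (t := t)
    (fun a b => hs.metric_eq t ht a b) (hs.posDef t ht).isUnit a b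
  convert h using 1
  simp

theorem hasDerivWithinAt_mixed (hs : IsSolution structV t₀ g k f) {t : ℝ} (ht : t ∈ Ici t₀)
    (a b : Fin 3) :
    HasDerivWithinAt (fun s => ((g s)⁻¹ * k s) a b)
      ((trg (g t) (k t) • ((g t)⁻¹ * k t)
        + (-2 * (g t)⁻¹ 0 0 + 4 * Real.pi * trg (g t) (stress (g t) (f t))
          - 4 * Real.pi * rho (g t) (f t)) • (1 : Mat)
        - (8 * Real.pi) • ((g t)⁻¹ * stress (g t) (f t))) a b) (Ici t₀) t := by
  have hg := hs.posDef t ht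
  have hk : ∀ a b, HasDerivWithinAt (fun s => k s a b)
      (((-2 * (g t)⁻¹ 0 0) • g t + trg (g t) (k t) • k t - (2 : ℝ) • (k t * ((g t)⁻¹ * k t))
        - (8 * Real.pi) • (stress (g t) (f t)
            - ((1 / 2) * trg (g t) (stress (g t) (f t))) • g t)
        - (4 * Real.pi * rho (g t) (f t)) • g t) a b) (Ici t₀) t := by
    intro a b
    convert hs.evolution_eq t ht a b using 1
    simp only [ricci_structV hg, mixed, Matrix.sub_apply, Matrix.add_apply, Matrix.smul_apply,
      Matrix.mul_apply (M := k t), smul_eq_mul]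
    ring
  convert hasDerivWithinAt_mul_apply (hs.hasDerivWithinAt_inv ht) hk a b using 1
  refine congrFun (congrFun ?_ a) b
  simp only [Matrix.mul_add, Matrix.mul_sub, Matrix.mul_smul, Matrix.smul_mul,
    inv_mul_of_posDef hg, Matrix.mul_assoc, smul_sub, sub_smul, add_smul]
  have : (2 : ℕ) • ((g t)⁻¹ * (k t * ((g t)⁻¹ * k t)))
      = (2 : ℝ) • ((g t)⁻¹ * (k t * ((g t)⁻¹ * k t))) := by
    simp [two_smul]
  rw [this]
  ext i j
  simp only [Matrix.add_apply, Matrix.sub_apply, Matrix.smul_apply, smul_eq_mul]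
  ring

theorem hasDerivWithinAt_hubble_aux (hs : IsSolution structV t₀ g k f) {t : ℝ}
    (ht : t ∈ Ici t₀) :
    HasDerivWithinAt (fun s => hubble (g s) (k s))
      (-3 * hubble (g t) (k t) ^ 2 + 2 * (g t)⁻¹ 0 0
        - 4 * Real.pi / 3 * trg (g t) (stress (g t) (f t))
        + 4 * Real.pi * rho (g t) (f t)) (Ici t₀) t := by
  have h := (hasDerivWithinAt_trace (hs.hasDerivWithinAt_mixed ht)).const_mul (-(1 / 3) : ℝ)
  have e : ∀ s ∈ Ici t₀, hubble (g s) (k s) = -(1 / 3) * ((g s)⁻¹ * k s).trace := by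
    intro s hs'
    rw [trace_inv_mul (hs.k_isSymm hs')]
    ring
  refine (h.congr e (e t ht)).congr_deriv ?_
  simp only [Matrix.trace_add, Matrix.trace_sub, Matrix.trace_smul, Matrix.trace_one,
    trace_inv_mul (hs.k_isSymm ht), trg_eq_trace _ (hs.k_isSymm ht),
    ← trg_eq_trace _ (stress_isSymm (g t) (f t))]
  simp
  ring

theorem hamiltonian_shearSq (hs : IsSolution structV t₀ g k f) {t : ℝ} (ht : t ∈ Ici t₀) :
    6 * hubble (g t) (k t) ^ 2 - shearSq (g t) (k t) - 6 * (g t)⁻¹ 0 0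
      = 16 * Real.pi * rho (g t) (f t) := by
  rw [← hs.hamiltonian t ht, shearSq_eq (hs.posDef t ht) (hs.k_isSymm ht),
    scalarR_structV (hs.posDef t ht), trg_eq_trace _ (hs.k_isSymm ht),
    trace_inv_mul (hs.k_isSymm ht)]
  simp only [mixed]
  ring

/-- Raychaudhuri's equation: a third of the Hamiltonian constraint trades the curvature for terms
that all have a sign. -/
theorem hasDerivWithinAt_hubble (hs : IsSolution structV t₀ g k f) {t : ℝ} (ht : t ∈ Ici t₀) :
    HasDerivWithinAt (fun s => hubble (g s) (k s))
      (-hubble (g t) (k t) ^ 2 - shearSq (g t) (k t) / 3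
        - 4 * Real.pi / 3 * (rho (g t) (f t) + trg (g t) (stress (g t) (f t)))) (Ici t₀) t := by
  refine (hs.hasDerivWithinAt_hubble_aux ht).congr_deriv ?_
  linear_combination (-1 / 3) * hs.hamiltonian_shearSq ht

/-- No curvature term appears because the Ricci tensor is pure trace; only the anisotropic stress
feeds the shear. -/
theorem hasDerivWithinAt_shearSq (hs : IsSolution structV t₀ g k f) {t : ℝ} (ht : t ∈ Ici t₀) :
    HasDerivWithinAt (fun s => shearSq (g s) (k s))
      (-6 * hubble (g t) (k t) * shearSq (g t) (k t)
        - 16 * Real.pi * shearStress (g t) (k t) (f t)) (Ici t₀) t := by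
  have hK := hs.hasDerivWithinAt_mixed ht
  have h := (hasDerivWithinAt_trace (hasDerivWithinAt_mul_apply hK hK)).sub
    (((hs.hasDerivWithinAt_hubble_aux ht).pow 2).const_mul 3)
  have e : ∀ s ∈ Ici t₀, shearSq (g s) (k s)
      = ((g s)⁻¹ * k s * ((g s)⁻¹ * k s)).trace - 3 * hubble (g s) (k s) ^ 2 :=
    fun s hs' => shearSq_eq (hs.posDef s hs') (hs.k_isSymm hs')
  refine (h.congr e (e t ht)).congr_deriv ?_
  rw [shearSq_eq (hs.posDef t ht) (hs.k_isSymm ht), shearStress_eq (hs.posDef t ht)]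
  have hc : ((g t)⁻¹ * stress (g t) (f t) * ((g t)⁻¹ * k t)).trace
      = ((g t)⁻¹ * k t * ((g t)⁻¹ * stress (g t) (f t))).trace := Matrix.trace_mul_comm _ _
  simp only [Matrix.mul_add, Matrix.add_mul, Matrix.mul_sub, Matrix.sub_mul, Matrix.trace_add,
    Matrix.trace_sub, Matrix.smul_mul, Matrix.mul_smul, Matrix.trace_smul, Matrix.mul_one,
    Matrix.one_mul, trace_inv_mul (hs.k_isSymm ht), trg_eq_trace _ (hs.k_isSymm ht), hc,
    smul_eq_mul]
  simp
  ring

/-- The momentum constraint contracted with `g^1b`. It makes the shear drop out of the evolution of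
`g^11`, leaving a matter term that is linear in `ρ`. -/
theorem sigma_up_zero (hs : IsSolution structV t₀ g k f) {t : ℝ} (ht : t ∈ Ici t₀) :
    3 * ((g t)⁻¹ * sigma (g t) (k t) * (g t)⁻¹) 0 0 = -8 * Real.pi * currentUp (g t) (f t) := by
  have hg := hs.posDef t ht
  have hGs := isSymm_inv hg
  have h1 : ∀ b, 8 * Real.pi * ((g t)⁻¹ 0 b * current (g t) (f t) b)
      = -3 * (((g t)⁻¹ * k t) 0 b * (g t)⁻¹ b 0)
        + (g t)⁻¹ 0 b * (if b = 0 then trg (g t) (k t) else 0) := by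
    intro b
    have h := hs.momentum t ht b
    rw [divg_structV hg (hs.k_isSymm ht)] at h
    rw [hGs.apply 0 b]
    linear_combination (-(g t)⁻¹ 0 b) * h
  have h2 : 8 * Real.pi * currentUp (g t) (f t)
      = -3 * ((g t)⁻¹ * k t * (g t)⁻¹) 0 0 + (g t)⁻¹ 0 0 * trg (g t) (k t) := by
    rw [currentUp, Finset.mul_sum, Finset.sum_congr rfl fun b _ => h1 b, Finset.sum_add_distrib,
      ← Finset.mul_sum, ← Matrix.mul_apply]
    simp
  rw [inv_mul_sigma hg]
  simp only [Matrix.add_mul, Matrix.add_apply, Matrix.smul_mul, Matrix.one_mul, Matrix.smul_apply,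
    smul_eq_mul, hubble]
  linear_combination h2

theorem hasDerivWithinAt_inv_diag (hs : IsSolution structV t₀ g k f) {t : ℝ} (ht : t ∈ Ici t₀)
    (i : Fin 3) :
    HasDerivWithinAt (fun s => (g s)⁻¹ i i)
      (-2 * hubble (g t) (k t) * (g t)⁻¹ i i
        + 2 * ((g t)⁻¹ * sigma (g t) (k t) * (g t)⁻¹) i i) (Ici t₀) t := by
  refine (hs.hasDerivWithinAt_inv ht i i).congr_deriv ?_
  rw [inv_mul_sigma (hs.posDef t ht)]
  simp [Matrix.add_mul, two_mul]
  ring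

theorem hasDerivWithinAt_inv_zero (hs : IsSolution structV t₀ g k f) {t : ℝ} (ht : t ∈ Ici t₀) :
    HasDerivWithinAt (fun s => (g s)⁻¹ 0 0)
      (-2 * hubble (g t) (k t) * (g t)⁻¹ 0 0 - 16 * Real.pi / 3 * currentUp (g t) (f t))
      (Ici t₀) t := by
  refine (hs.hasDerivWithinAt_inv_diag ht 0).congr_deriv ?_
  linear_combination (2 / 3) * hs.sigma_up_zero ht

end IsSolution

/-! ### Propagation of the momentum support -/

/-- The momentum component of the Vlasov characteristic field. -/
def velocity (g : Mat) (p : Mom) : Mom := fun a =>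
  (energy g p)⁻¹ * ∑ b, ∑ d, structV d b a * raise g p b * p d

/-- By antisymmetry of `C^d_ba` in `a, b`: along a characteristic, `|p|²` changes only because the
metric does. -/
theorem sum_raise_mul_velocity (g : Mat) (p : Mom) : ∑ a, raise g p a * velocity g p a = 0 := by
  simp [velocity, structV, Fin.sum_univ_three]
  ring

theorem coord_sq_le {g : Mat} (hg : g.PosDef) (p : Mom) (i : Fin 3) :
    p i ^ 2 ≤ g i i * normSq g p := by
  have h := bilin_sq_le hg.inv (g.mulVec (Pi.single i 1)) p
  have e2 : g⁻¹.mulVec (g.mulVec (Pi.single i 1)) = (Pi.single i 1 : Mom) := by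
    rw [Matrix.mulVec_mulVec, inv_mul_of_posDef hg, Matrix.one_mulVec]
  have e1 : quad g⁻¹ (g.mulVec (Pi.single i 1)) = g i i := by
    rw [quad_eq, e2]
    simp
  rw [e1, e2] at h
  simp only [dotProduct_single, mul_one] at h
  rwa [mul_comm] at h

theorem quad_inv_mul_inv {g : Mat} (hg : g.PosDef) (k : Mat) (p : Mom) :
    quad (g⁻¹ * k * g⁻¹) p
      = quad (g⁻¹ * sigma g k * g⁻¹) p - hubble g k * normSq g p := by
  have e : g⁻¹ * k * g⁻¹ = g⁻¹ * sigma g k * g⁻¹ - hubble g k • g⁻¹ := by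
    rw [inv_mul_sigma hg, Matrix.add_mul, Matrix.smul_mul, Matrix.one_mul, add_sub_cancel_right]
  rw [e, normSq_eq_quad]
  simp only [quad, Finset.mul_sum, ← Finset.sum_sub_distrib]
  exact Finset.sum_congr rfl fun a _ => Finset.sum_congr rfl fun b _ => by
    simp only [Matrix.sub_apply, Matrix.smul_apply, smul_eq_mul]
    ring

/-- A barrier read backwards in time: a constraint that could only be crossed downwards was
satisfied just before `t`. -/
theorem eventually_left_nonneg {φ : ℝ → ℝ} {φ' t : ℝ} (h : HasDerivAt φ φ' t) (h0 : 0 ≤ φ t)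
    (h1 : φ t = 0 → φ' < 0) : ∀ᶠ s in 𝓝[<] t, 0 ≤ φ s := by
  rcases h0.eq_or_lt with h0 | h0
  · have h2 := (hasDerivAt_iff_tendsto_slope.mp h).mono_left
      (nhdsWithin_mono t (fun s (hs : s < t) => ne_of_lt hs))
    filter_upwards [h2.eventually (gt_mem_nhds (h1 h0.symm)), self_mem_nhdsWithin] with s hs hst
    rw [slope_def_field, ← h0, sub_zero, div_lt_iff_of_neg (sub_neg.mpr hst)] at hs
    linarith
  · exact nhdsWithin_le_nhds ((h.continuousAt.eventually (lt_mem_nhds h0)).mono fun _ => le_of_lt)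

namespace IsSolution

variable {t₀ : ℝ} {g k : ℝ → Mat} {f : ℝ → Mom → ℝ}

theorem continuousOn_hubble (hs : IsSolution structV t₀ g k f) :
    ContinuousOn (fun t => hubble (g t) (k t)) (Ici t₀) :=
  fun _ ht => (hs.hasDerivWithinAt_hubble ht).continuousWithinAt

theorem continuousOn_shearSq (hs : IsSolution structV t₀ g k f) :
    ContinuousOn (fun t => shearSq (g t) (k t)) (Ici t₀) :=
  fun _ ht => (hs.hasDerivWithinAt_shearSq ht).continuousWithinAt

theorem continuousOn_normSq (hs : IsSolution structV t₀ g k f) :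
    ContinuousOn (fun x : ℝ × Mom => normSq (g x.1) x.2) (Ici t₀ ×ˢ univ) := by
  have hG : ∀ a b, ContinuousOn (fun x : ℝ × Mom => (g x.1)⁻¹ a b) (Ici t₀ ×ˢ univ) := by
    intro a b
    have h : ContinuousOn (fun t => (g t)⁻¹ a b) (Ici t₀) :=
      fun _ ht => (hs.hasDerivWithinAt_inv ht a b).continuousWithinAt
    exact h.comp continuousOn_fst fun x hx => hx.1
  refine continuousOn_finsetSum _ fun a _ => continuousOn_finsetSum _ fun b _ =>
    ((hG a b).mul ?_).mul ?_
  · exact (continuous_apply a).comp_continuousOn continuousOn_snd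
  · exact (continuous_apply b).comp_continuousOn continuousOn_snd

theorem hasDerivAt_normSq_line (hs : IsSolution structV t₀ g k f) {t : ℝ} (ht : t₀ < t)
    (p : Mom) :
    HasDerivAt (fun s => normSq (g s) (p + (s - t) • velocity (g t) p))
      (2 * quad ((g t)⁻¹ * k t * (g t)⁻¹) p) t := by
  have hq : ∀ a, HasDerivAt (fun s => (p + (s - t) • velocity (g t) p) a) (velocity (g t) p a) t :=
    fun a => by
      simpa using (((hasDerivAt_id t).sub_const t).mul_const (velocity (g t) p a)).const_add (p a)
  have hG : ∀ a b, HasDerivAt (fun s => (g s)⁻¹ a b)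
      ((2 • ((g t)⁻¹ * k t * (g t)⁻¹)) a b) t :=
    fun a b => (hs.hasDerivWithinAt_inv (mem_Ici.mpr ht.le) a b).hasDerivAt (Ici_mem_nhds ht)
  have h : HasDerivAt (fun s => normSq (g s) (p + (s - t) • velocity (g t) p)) _ t :=
    HasDerivAt.fun_sum fun a _ => HasDerivAt.fun_sum fun b _ => ((hG a b).mul (hq a)).mul (hq b)
  refine h.congr_deriv ?_
  have hGs := isSymm_inv (hs.posDef t (mem_Ici.mpr ht.le))
  have h0 := sum_raise_mul_velocity (g t) p
  simp only [raise, quad, Fin.sum_univ_three, hGs.apply 0 1, hGs.apply 0 2, hGs.apply 1 2]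
    at h0 ⊢
  simp only [sub_self, zero_smul, add_zero, Matrix.smul_apply, nsmul_eq_mul, Pi.mul_apply,
    hGs.apply 0 1, hGs.apply 0 2, hGs.apply 1 2]
  push_cast
  linear_combination 2 * h0

/-- The tangent line of the characteristic replaces the characteristic itself: first-order
information at one point is all that the maximum argument below needs, so no flow has to be
constructed. -/
theorem hasDerivAt_f_line (hs : IsSolution structV t₀ g k f) {t : ℝ} (ht : t₀ < t) (p : Mom) :
    HasDerivAt (fun s => f s (p + (s - t) • velocity (g t) p)) 0 t := by
  have hn : Ici t₀ ×ˢ (univ : Set Mom) ∈ 𝓝 (t, p) := prod_mem_nhds (Ici_mem_nhds ht) univ_mem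
  have hd : DifferentiableAt ℝ (fun x : ℝ × Mom => f x.1 x.2) (t, p) :=
    (hs.smooth_f.contDiffAt hn).differentiableAt (by simp)
  obtain ⟨Φ, hΦ⟩ : ∃ Φ, HasFDerivAt (fun x : ℝ × Mom => f x.1 x.2) Φ (t, p) := ⟨_, hd.hasFDerivAt⟩
  have h1 : HasDerivAt (fun s => f s p) (Φ (1, 0)) t :=
    hΦ.comp_hasDerivAt (f := fun s => (s, p)) t
      ((hasDerivAt_id t).prodMk (hasDerivAt_const t p))
  have h2 := ((hs.vlasov t (mem_Ici.mpr ht.le) p).hasDerivAt (Ici_mem_nhds ht)).unique h1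
  have h3 : HasFDerivAt (f t) (Φ.comp (ContinuousLinearMap.inr ℝ ℝ Mom)) p :=
    hΦ.comp (f := fun q => (t, q)) p (hasFDerivAt_prodMk_right t p)
  have hq : HasDerivAt (fun s => p + (s - t) • velocity (g t) p) (velocity (g t) p) t := by
    simpa using (((hasDerivAt_id t).sub_const t).smul_const (velocity (g t) p)).const_add p
  have h4 : HasDerivAt (fun s => f s (p + (s - t) • velocity (g t) p))
      (Φ (1, velocity (g t) p)) t := by
    have hΦ' : HasFDerivAt (fun x : ℝ × Mom => f x.1 x.2) Φ
        (t, p + (t - t) • velocity (g t) p) := by simpa using hΦ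
    exact hΦ'.comp_hasDerivAt (f := fun s => (s, p + (s - t) • velocity (g t) p)) t
      ((hasDerivAt_id t).prodMk hq)
  refine h4.congr_deriv ?_
  have h5 : Φ (1, velocity (g t) p) = Φ (1, 0) + Φ (0, velocity (g t) p) := by
    rw [← map_add]
    simp
  have h6 : Φ (0, velocity (g t) p)
      = ∑ a, velocity (g t) p a * fderiv ℝ (f t) p (Pi.single a 1) := by
    rw [h3.fderiv]
    have : velocity (g t) p = ∑ a, velocity (g t) p a • (Pi.single a 1 : Mom) := by
      ext i
      simp [Pi.single_apply]
    have h7 : Φ (0, velocity (g t) p)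
        = (Φ.comp (ContinuousLinearMap.inr ℝ ℝ Mom)) (velocity (g t) p) := by simp
    rw [h7]
    conv_lhs => rw [this]
    rw [map_sum]
    simp
  rw [h5, ← h2, h6]
  simp only [velocity, Finset.mul_sum, Finset.sum_mul]
  rw [neg_add_eq_zero]
  exact Finset.sum_congr rfl fun a _ => Finset.sum_congr rfl fun b _ =>
    Finset.sum_congr rfl fun d _ => by ring

/-- Maximum principle by contradiction. On a compact region `B ≤ |p|² ≤ D` of phase space take a
maximum of `e^(-t) f`. It is positive, so `h0` excludes the time `t₀`; at a later time, a small step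
backwards along the tangent of the characteristic stays in the region and increases `e^(-t) f`. -/
theorem normSq_lt_of_ne_zero_aux (hs : IsSolution structV t₀ g k f) {T : ℝ} (hT : t₀ ≤ T)
    {B B' : ℝ → ℝ} (hB : ∀ t ∈ Ici t₀, HasDerivWithinAt B (B' t) (Ici t₀) t)
    (hpos : ∀ t ∈ Icc t₀ T, 0 < B t)
    (hlt : ∀ t ∈ Icc t₀ T,
      -2 * (hubble (g t) (k t) - √(shearSq (g t) (k t))) * B t < B' t)
    (h0 : ∀ p, f t₀ p ≠ 0 → normSq (g t₀) p < B t₀) (p : Mom) (hp : f T p ≠ 0) :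
    normSq (g T) p < B T := by
  by_contra! hcon
  have hTI : T ∈ Icc t₀ T := ⟨hT, le_rfl⟩
  have hsub : Icc t₀ T ⊆ Ici t₀ := Icc_subset_Ici_self
  obtain ⟨L, hL⟩ : ∃ L : ℝ, ∀ t ∈ Icc t₀ T,
      2 * (hubble (g t) (k t) + √(shearSq (g t) (k t))) < L := by
    have hc : ContinuousOn (fun t => 2 * (hubble (g t) (k t) + √(shearSq (g t) (k t))))
        (Icc t₀ T) :=
      (continuousOn_const.mul (hs.continuousOn_hubble.add hs.continuousOn_shearSq.sqrt)).mono hsub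
    obtain ⟨L, hL⟩ := isCompact_Icc.bddAbove_image hc
    exact ⟨L + 1, fun t ht => by linarith [hL (mem_image_of_mem _ ht)]⟩
  -- The upper barrier passes through the bad point at time `T` and, by the choice of `L`, grows
  -- backwards in time faster than `|p|²` can.
  set D : ℝ → ℝ := fun t => normSq (g T) p * Real.exp (-L * (t - T)) with hD
  have hD' : ∀ t, HasDerivAt D (-L * D t) t := by
    intro t
    have h := ((((hasDerivAt_id t).sub_const T).const_mul (-L)).exp).const_mul (normSq (g T) p)
    refine h.congr_deriv ?_
    simp [hD]
    ring
  have hDc : Continuous D := by fun_prop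
  set K : Set (ℝ × Mom) := (Icc t₀ T ×ˢ univ) ∩
    {x | B x.1 ≤ normSq (g x.1) x.2 ∧ normSq (g x.1) x.2 ≤ D x.1} with hK
  have hKc : IsClosed K := by
    have hBc : ContinuousOn (fun x : ℝ × Mom => B x.1) (Icc t₀ T ×ˢ univ) := by
      have h : ContinuousOn B (Icc t₀ T) := fun t ht => ((hB t (hsub ht)).continuousWithinAt).mono hsub
      exact h.comp continuousOn_fst fun x hx => hx.1
    have hN := hs.continuousOn_normSq.mono (prod_mono hsub (subset_refl univ))
    have hcl : IsClosed (Icc t₀ T ×ˢ (univ : Set Mom)) := isClosed_Icc.prod isClosed_univ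
    have h1 := (hN.sub hBc).preimage_isClosed_of_isClosed hcl (isClosed_Ici (a := (0 : ℝ)))
    have h2 := (((hDc.comp continuous_fst).continuousOn).sub hN).preimage_isClosed_of_isClosed hcl
      (isClosed_Ici (a := (0 : ℝ)))
    convert h1.inter h2 using 1
    ext x
    simp only [hK, mem_inter_iff, mem_ofPred_eq, mem_preimage, mem_Ici, sub_nonneg,
      Pi.sub_apply, Function.comp_apply]
    tauto
  have hR : ∀ i : Fin 3, ∃ R : ℝ, ∀ t ∈ Icc t₀ T, g t i i * D t ≤ R := by
    intro i
    have hc : ContinuousOn (fun t => g t i i * D t) (Icc t₀ T) :=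
      ((hs.smooth_g i i).continuousOn.mono hsub).mul hDc.continuousOn
    obtain ⟨R, hR⟩ := isCompact_Icc.bddAbove_image hc
    exact ⟨R, fun t ht => hR (mem_image_of_mem _ ht)⟩
  choose R hR using hR
  have hKcomp : IsCompact K := by
    refine ((isCompact_Icc (a := t₀) (b := T)).prod (isCompact_closedBall (0 : Mom) (1 + ∑ i, |R i|))).of_isClosed_subset
      hKc ?_
    rintro ⟨t, q⟩ ⟨⟨ht, -⟩, -, hq⟩
    refine ⟨ht, ?_⟩
    have hsum : 0 ≤ ∑ i, |R i| := Finset.sum_nonneg fun i _ => abs_nonneg _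
    rw [mem_closedBall_zero_iff, pi_norm_le_iff_of_nonneg (by positivity)]
    intro i
    have hg := hs.posDef t (hsub ht)
    have h1 := coord_sq_le hg q i
    have h2 : g t i i * normSq (g t) q ≤ g t i i * D t :=
      mul_le_mul_of_nonneg_left hq hg.diag_pos.le
    have h3 : |R i| ≤ ∑ i, |R i| :=
      Finset.single_le_sum (f := fun i => |R i|) (fun i _ => abs_nonneg _) (Finset.mem_univ i)
    rw [Real.norm_eq_abs]
    refine abs_le_of_sq_le_sq ?_ (by positivity)
    nlinarith [hR i t ht, le_abs_self (R i)]
  have hpK : (T, p) ∈ K := ⟨⟨hTI, mem_univ _⟩, hcon, by simp [hD]⟩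
  have hFc : ContinuousOn (fun x : ℝ × Mom => Real.exp (-x.1) * f x.1 x.2) K := by
    refine ContinuousOn.mul (by fun_prop) (hs.smooth_f.continuousOn.mono ?_)
    exact fun x hx => ⟨hsub hx.1.1, mem_univ _⟩
  obtain ⟨⟨t, q⟩, hqK, hmax⟩ := hKcomp.exists_isMaxOn ⟨_, hpK⟩ hFc
  have htI : t ∈ Icc t₀ T := hqK.1.1
  have hfpos : 0 < f t q := by
    have h1 : Real.exp (-T) * f T p ≤ Real.exp (-t) * f t q := hmax hpK
    have h2 : 0 < f T p := lt_of_le_of_ne (hs.f_nonneg T hT p) hp.symm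
    have h3 : 0 < Real.exp (-t) * f t q := lt_of_lt_of_le (by positivity) h1
    exact pos_of_mul_pos_right h3 (Real.exp_pos _).le
  have htlt : t₀ < t := by
    refine lt_of_le_of_ne htI.1 ?_
    rintro rfl
    exact absurd (h0 q hfpos.ne') (not_lt.mpr hqK.2.1)
  have hg := hs.posDef t htI.1
  have hN := hs.hasDerivAt_normSq_line htlt q
  have hquad := abs_le.mp (abs_quad_le hg.inv (sigma_isSymm hg (hs.k_isSymm htI.1)) q)
  have hke := quad_inv_mul_inv hg (k t) q
  rw [← normSq_eq_quad] at hquad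
  change -(√(shearSq (g t) (k t)) * _) ≤ _ ∧ _ ≤ √(shearSq (g t) (k t)) * _ at hquad
  have hNpos : 0 < normSq (g t) q := lt_of_lt_of_le (hpos t htI) hqK.2.1
  -- Strictness of the supersolution `B` keeps the backward step above the lower boundary; `e2` does
  -- the same for `D`.
  have e1 := eventually_left_nonneg (hN.sub ((hB t htI.1).hasDerivAt (Ici_mem_nhds htlt)))
    (by simpa using hqK.2.1) (fun h => by
      have h' : normSq (g t) q = B t := by simpa [sub_eq_zero] using h
      have := hlt t htI
      rw [← h'] at this
      rw [hke]
      linarith [hquad.2])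
  have e2 := eventually_left_nonneg ((hD' t).sub hN)
    (by simpa using hqK.2.2) (fun h => by
      have h' : D t = normSq (g t) q := by simpa [sub_eq_zero] using h
      have := mul_lt_mul_of_pos_right (hL t htI) hNpos
      rw [h', hke]
      linarith [hquad.1])
  -- Since `f` is stationary to first order, the factor `e^(-t)` makes the derivative strictly
  -- negative.
  have hF := ((hasDerivAt_id t).neg.exp).mul (hs.hasDerivAt_f_line htlt q)
  have e3 : ∀ᶠ s in 𝓝[<] t, Real.exp (-t) * f t q
      < Real.exp (-s) * f s (q + (s - t) • velocity (g t) q) := by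
    have h2 := (hasDerivAt_iff_tendsto_slope.mp hF).mono_left
      (nhdsWithin_mono t (fun s (hs : s < t) => ne_of_lt hs))
    have hneg : Real.exp (-id t) * -1 * f t (q + (t - t) • velocity (g t) q)
        + Real.exp (-id t) * 0 < 0 := by
      have := mul_pos (Real.exp_pos (-t)) hfpos
      simp
      linarith
    filter_upwards [h2.eventually (gt_mem_nhds hneg), self_mem_nhdsWithin] with s hs' hst
    rw [slope_def_field, div_lt_iff_of_neg (sub_neg.mpr hst)] at hs'
    simp at hs'
    exact hs'
  have e4 : ∀ᶠ s in 𝓝[<] t, t₀ < s := nhdsWithin_le_nhds (lt_mem_nhds htlt)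
  obtain ⟨s, h1, h2, h3, h4, h5⟩ :=
    (e1.and (e2.and (e3.and (e4.and self_mem_nhdsWithin)))).exists
  have hsK : (s, q + (s - t) • velocity (g t) q) ∈ K :=
    ⟨⟨⟨h4.le, (le_of_lt h5).trans htI.2⟩, mem_univ _⟩, sub_nonneg.mp h1, sub_nonneg.mp h2⟩
  exact absurd (hmax hsK) (not_le.mpr h3)

/-- If `B` is a strict supersolution of the equation satisfied by `|p|²` along the Vlasov
characteristics, then `|p|² < B` propagates on the support of `f`. -/
theorem normSq_lt_of_ne_zero (hs : IsSolution structV t₀ g k f) {T : ℝ}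
    {B B' : ℝ → ℝ} (hB : ∀ t ∈ Ici t₀, HasDerivWithinAt B (B' t) (Ici t₀) t)
    (hpos : ∀ t ∈ Icc t₀ T, 0 < B t)
    (hlt : ∀ t ∈ Icc t₀ T,
      -2 * (hubble (g t) (k t) - √(shearSq (g t) (k t))) * B t < B' t)
    (h0 : ∀ p, f t₀ p ≠ 0 → normSq (g t₀) p < B t₀) {t : ℝ} (ht : t ∈ Icc t₀ T) (p : Mom)
    (hp : f t p ≠ 0) : normSq (g t) p < B t :=
  hs.normSq_lt_of_ne_zero_aux ht.1 hB (fun s hs' => hpos s ⟨hs'.1, hs'.2.trans ht.2⟩)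
    (fun s hs' => hlt s ⟨hs'.1, hs'.2.trans ht.2⟩) h0 p hp

end IsSolution

/-! ### Differential inequalities on a half-line -/

theorem le_of_hasDerivWithinAt_nonpos {t₀ T : ℝ} (hT : t₀ ≤ T) {φ φ' : ℝ → ℝ}
    (h : ∀ t ∈ Ici t₀, HasDerivWithinAt φ (φ' t) (Ici t₀) t) (h' : ∀ t ∈ Icc t₀ T, φ' t ≤ 0) :
    φ T ≤ φ t₀ := by
  refine antitoneOn_of_hasDerivWithinAt_nonpos (D := Icc t₀ T) (f' := φ') (convex_Icc _ _)
    (fun t ht => (h t ht.1).continuousWithinAt.mono Icc_subset_Ici_self) (fun t ht => ?_)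
    (fun t ht => ?_) ⟨le_rfl, hT⟩ ⟨hT, le_rfl⟩ hT
  · exact (h t (interior_subset ht).1).mono (interior_subset.trans Icc_subset_Ici_self)
  · exact h' t (interior_subset ht)

/-- Continuity argument: at the first time `t₁` with `y t₁ = c`, the hypothesis `h` would give `y t₁
≤ y t₀ < c`. -/
theorem le_init_of_bootstrap {t₀ c : ℝ} {y : ℝ → ℝ} (hy : ContinuousOn y (Ici t₀))
    (h0 : y t₀ < c) (h : ∀ T, t₀ ≤ T → (∀ s ∈ Icc t₀ T, y s ≤ c) → y T ≤ y t₀) {t : ℝ}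
    (ht : t₀ ≤ t) : y t ≤ y t₀ := by
  have hc : ∀ s, t₀ ≤ s → y s ≤ c := by
    by_contra! hcon
    obtain ⟨T, hT, hyT⟩ := hcon
    have hex : ∀ s, t₀ ≤ s → c < y s → ∃ r ∈ Icc t₀ s, y r = c := fun s hs hys =>
      intermediate_value_Icc hs (hy.mono Icc_subset_Ici_self) ⟨h0.le, hys.le⟩
    have hcomp : IsCompact (Icc t₀ T ∩ y ⁻¹' {c}) :=
      isCompact_Icc.of_isClosed_subset ((hy.mono Icc_subset_Ici_self).preimage_isClosed_of_isClosed
        isClosed_Icc isClosed_singleton) inter_subset_left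
    obtain ⟨r, hr, hyr⟩ := hex T hT hyT
    obtain ⟨t₁, ⟨ht₁, hyt₁⟩, hleast⟩ := hcomp.exists_isLeast ⟨r, hr, hyr⟩
    have h1 : y t₁ ≤ y t₀ := by
      refine h t₁ ht₁.1 fun s hs => ?_
      by_contra! hys
      obtain ⟨r', hr', hyr'⟩ := hex s hs.1 hys
      have h2 : t₁ ≤ r' := hleast ⟨⟨hr'.1, hr'.2.trans (hs.2.trans ht₁.2)⟩, hyr'⟩
      have h3 : s = t₁ := le_antisymm hs.2 (h2.trans hr'.2)
      rw [h3] at hys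
      exact hys.ne' hyt₁
    have h2 : y t₁ = c := hyt₁
    linarith
  exact h t ht fun s hs => hc s hs.1

theorem hasDerivWithinAt_rpow {t : ℝ} (ht : 0 < t) (m : ℝ) (s : Set ℝ) :
    HasDerivWithinAt (fun x : ℝ => x ^ m) (m * t ^ (m - 1)) s t :=
  (Real.hasDerivAt_rpow_const (Or.inl ht.ne')).hasDerivWithinAt

/-- Gronwall with an integrable coefficient: `-4 C t^(-1/4)` is a primitive of `C t^(-5/4)`, so `log
(1 + u) + 4 C t^(-1/4)` is nonincreasing. -/
theorem exists_bound_of_deriv_le {t₀ C : ℝ} (ht₀ : 0 < t₀) {u u' : ℝ → ℝ}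
    (hu : ∀ t ∈ Ici t₀, HasDerivWithinAt u (u' t) (Ici t₀) t) (h0 : ∀ t ∈ Ici t₀, 0 ≤ u t)
    (h : ∀ t ∈ Ici t₀, u' t ≤ C * t ^ (-(5 / 4) : ℝ) * (1 + u t)) :
    ∃ M, ∀ t ∈ Ici t₀, u t ≤ M := by
  have hd : ∀ t ∈ Ici t₀, HasDerivWithinAt
      (fun s => Real.log (1 + u s) + 4 * C * s ^ (-(1 / 4) : ℝ))
      (u' t / (1 + u t) + 4 * C * (-(1 / 4) * t ^ (-(1 / 4) - 1 : ℝ))) (Ici t₀) t := by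
    intro t ht
    have h1 : 0 < 1 + u t := by linarith [h0 t ht]
    exact (((hu t ht).const_add 1).log h1.ne').add
      ((hasDerivWithinAt_rpow (ht₀.trans_le ht) _ _).const_mul _)
  have hle : ∀ t ∈ Ici t₀,
      u' t / (1 + u t) + 4 * C * (-(1 / 4) * t ^ (-(1 / 4) - 1 : ℝ)) ≤ 0 := by
    intro t ht
    have h1 : 0 < 1 + u t := by linarith [h0 t ht]
    have h2 : u' t / (1 + u t) ≤ C * t ^ (-(5 / 4) : ℝ) := (div_le_iff₀ h1).mpr (h t ht)
    have h3 : (-(1 / 4) - 1 : ℝ) = -(5 / 4) := by norm_num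
    rw [h3]
    linarith
  refine ⟨Real.exp (Real.log (1 + u t₀) + 4 * |C| * t₀ ^ (-(1 / 4) : ℝ)
    + 4 * |C| * t₀ ^ (-(1 / 4) : ℝ)), fun t ht => ?_⟩
  have h1 : 0 < 1 + u t := by linarith [h0 t ht]
  have h2 := le_of_hasDerivWithinAt_nonpos ht hd fun s hs => hle s hs.1
  have htpos : 0 < t := ht₀.trans_le ht
  have h3 : t ^ (-(1 / 4) : ℝ) ≤ t₀ ^ (-(1 / 4) : ℝ) :=
    Real.rpow_le_rpow_of_nonpos ht₀ ht (by norm_num)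
  have h4 : Real.log (1 + u t) ≤ Real.log (1 + u t₀) + 4 * |C| * t₀ ^ (-(1 / 4) : ℝ)
      + 4 * |C| * t₀ ^ (-(1 / 4) : ℝ) := by
    have p1 : 0 ≤ t ^ (-(1 / 4) : ℝ) := by positivity
    have p2 : 0 ≤ t₀ ^ (-(1 / 4) : ℝ) := by positivity
    have q1 : C * t₀ ^ (-(1 / 4) : ℝ) ≤ |C| * t₀ ^ (-(1 / 4) : ℝ) :=
      mul_le_mul_of_nonneg_right (le_abs_self C) p2
    have q2 : -C * t ^ (-(1 / 4) : ℝ) ≤ |C| * t ^ (-(1 / 4) : ℝ) :=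
      mul_le_mul_of_nonneg_right (neg_le_abs C) p1
    have q3 : |C| * t ^ (-(1 / 4) : ℝ) ≤ |C| * t₀ ^ (-(1 / 4) : ℝ) :=
      mul_le_mul_of_nonneg_left h3 (abs_nonneg C)
    linarith
  have h5 := (Real.log_le_iff_le_exp h1).mp h4
  linarith

/-! ### The scalar evolution system -/

/-- The evolution and constraint equations for the Hubble parameter `H`, `a = g^11`, the squared
shear `w`, and the matter quantities `ρ`, `S = g^ab S_ab`, `J = j^1`, `X = σ^ab S_ab`. -/
structure ShearFlow (t₀ : ℝ) (H a w ρ S J X : ℝ → ℝ) : Prop where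
  pos : 0 < t₀
  init : H t₀ = t₀⁻¹
  a_pos : ∀ t ∈ Ici t₀, 0 < a t
  w_nonneg : ∀ t ∈ Ici t₀, 0 ≤ w t
  S_nonneg : ∀ t ∈ Ici t₀, 0 ≤ S t
  S_le : ∀ t ∈ Ici t₀, S t ≤ ρ t
  abs_X_le : ∀ t ∈ Ici t₀, |X t| ≤ √(w t) * S t
  constraint : ∀ t ∈ Ici t₀, 6 * H t ^ 2 - w t - 6 * a t = 16 * Real.pi * ρ t
  deriv_H : ∀ t ∈ Ici t₀, HasDerivWithinAt H
    (-H t ^ 2 - w t / 3 - 4 * Real.pi / 3 * (ρ t + S t)) (Ici t₀) t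
  deriv_a : ∀ t ∈ Ici t₀, HasDerivWithinAt a
    (-2 * H t * a t - 16 * Real.pi / 3 * J t) (Ici t₀) t
  deriv_w : ∀ t ∈ Ici t₀, HasDerivWithinAt w
    (-6 * H t * w t - 16 * Real.pi * X t) (Ici t₀) t

namespace ShearFlow

variable {t₀ : ℝ} {H a w ρ S J X : ℝ → ℝ}

theorem rho_nonneg (h : ShearFlow t₀ H a w ρ S J X) {t : ℝ} (ht : t ∈ Ici t₀) : 0 ≤ ρ t :=
  (h.S_nonneg t ht).trans (h.S_le t ht)

theorem time_pos (h : ShearFlow t₀ H a w ρ S J X) {t : ℝ} (ht : t ∈ Ici t₀) : 0 < t :=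
  h.pos.trans_le ht

theorem a_le (h : ShearFlow t₀ H a w ρ S J X) {t : ℝ} (ht : t ∈ Ici t₀) : a t ≤ H t ^ 2 := by
  have h1 := h.constraint t ht
  have h2 := h.w_nonneg t ht
  have h3 := mul_nonneg Real.pi_pos.le (h.rho_nonneg ht)
  linarith

/-- At a zero of `H` the constraint would force `a ≤ 0`: negative spatial curvature excludes
recollapse. -/
theorem H_pos (h : ShearFlow t₀ H a w ρ S J X) {t : ℝ} (ht : t ∈ Ici t₀) : 0 < H t := by
  have hc : ContinuousOn H (Icc t₀ t) :=
    fun s hs => (h.deriv_H s hs.1).continuousWithinAt.mono Icc_subset_Ici_self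
  have h0 : 0 < H t₀ := by
    rw [h.init]
    exact inv_pos.mpr h.pos
  by_contra! hcon
  obtain ⟨s, hs, hHs⟩ := intermediate_value_Icc' ht hc ⟨hcon, h0.le⟩
  have h1 := h.a_le hs.1
  have h2 := h.a_pos s hs.1
  rw [hHs] at h1
  norm_num at h1
  linarith

theorem deficit_eq (h : ShearFlow t₀ H a w ρ S J X) {t : ℝ} (ht : t ∈ Ici t₀) :
    (1 - a t / H t ^ 2) * H t ^ 2 = w t / 6 + 8 * Real.pi / 3 * ρ t := by
  have hH := (h.H_pos ht).ne'
  have h1 := h.constraint t ht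
  field_simp
  linarith

theorem deficit_nonneg (h : ShearFlow t₀ H a w ρ S J X) {t : ℝ} (ht : t ∈ Ici t₀) :
    0 ≤ 1 - a t / H t ^ 2 := by
  rw [sub_nonneg, div_le_one (pow_pos (h.H_pos ht) 2)]
  exact h.a_le ht

theorem w_le (h : ShearFlow t₀ H a w ρ S J X) {t : ℝ} (ht : t ∈ Ici t₀) :
    w t ≤ 6 * (1 - a t / H t ^ 2) * H t ^ 2 := by
  have h1 := h.deficit_eq ht
  have h3 := mul_nonneg Real.pi_pos.le (h.rho_nonneg ht)
  linarith

theorem sqrt_w_le (h : ShearFlow t₀ H a w ρ S J X) {t : ℝ} (ht : t ∈ Ici t₀) {c : ℝ} (hc : 0 ≤ c)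
    (hy : 6 * (1 - a t / H t ^ 2) ≤ c ^ 2) : √(w t) ≤ c * H t := by
  have hH := h.H_pos ht
  refine Real.sqrt_le_iff.mpr ⟨by positivity, (h.w_le ht).trans ?_⟩
  rw [mul_pow]
  exact mul_le_mul_of_nonneg_right hy (by positivity)

theorem deriv_deficit (h : ShearFlow t₀ H a w ρ S J X) {t : ℝ} (ht : t ∈ Ici t₀) :
    HasDerivWithinAt (fun s => 1 - a s / H s ^ 2)
      (16 * Real.pi / 3 * J t / H t ^ 2
        - 2 * (a t / H t ^ 2) * (w t / 3 + 4 * Real.pi / 3 * (ρ t + S t)) / H t) (Ici t₀) t := by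
  have hH := (h.H_pos ht).ne'
  refine (((h.deriv_a t ht).div ((h.deriv_H t ht).pow 2) (pow_ne_zero 2 hH)).const_sub
    1).congr_deriv ?_
  simp only [Pi.pow_apply]
  field_simp
  ring

theorem continuousOn_deficit (h : ShearFlow t₀ H a w ρ S J X) :
    ContinuousOn (fun s => 1 - a s / H s ^ 2) (Ici t₀) :=
  fun _ ht => (h.deriv_deficit ht).continuousWithinAt

/-- To leading order the energy part of `y H²` is damped at rate `H` and the shear part at rate `4
H`. The current, at most `H ρ / 10`, costs a fifth of the former, and `a / H² ≥ 999/1000` costs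
little more, so the rate `3/4` survives. -/
theorem deriv_deficit_le (h : ShearFlow t₀ H a w ρ S J X) {t : ℝ} (ht : t ∈ Ici t₀)
    (hy : 1 - a t / H t ^ 2 ≤ 1 / 1000) (hJ : |J t| ≤ √(a t * (1 / 100)) * ρ t) :
    16 * Real.pi / 3 * J t / H t ^ 2
        - 2 * (a t / H t ^ 2) * (w t / 3 + 4 * Real.pi / 3 * (ρ t + S t)) / H t
      ≤ -(3 / 4) * H t * (1 - a t / H t ^ 2) := by
  have hH := h.H_pos ht
  have hρ := h.rho_nonneg ht
  have hw := h.w_nonneg t ht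
  have hS := h.S_nonneg t ht
  have hpi := Real.pi_pos
  have h1 : √(a t * (1 / 100)) ≤ H t / 10 := by
    refine Real.sqrt_le_iff.mpr ⟨by positivity, ?_⟩
    have := h.a_le ht
    nlinarith
  have h2 : J t ≤ H t / 10 * ρ t :=
    (le_abs_self _).trans (hJ.trans (mul_le_mul_of_nonneg_right h1 hρ))
  have h3 : -(3 / 4) * H t * (1 - a t / H t ^ 2)
      = -(3 / 4) * (w t / 6 + 8 * Real.pi / 3 * ρ t) / H t := by
    rw [← h.deficit_eq ht]
    field_simp
  have h4 : 16 * Real.pi / 3 * J t / H t ^ 2 = 16 * Real.pi / 3 * (J t / H t) / H t := by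
    field_simp
  rw [h3, h4, ← sub_div]
  refine div_le_div_of_nonneg_right ?_ hH.le
  have h5 : J t / H t ≤ ρ t / 10 := by
    rw [div_le_iff₀ hH]
    linarith
  have h6 : 16 * Real.pi / 3 * (J t / H t) ≤ 16 * Real.pi / 3 * (ρ t / 10) :=
    mul_le_mul_of_nonneg_left h5 (by positivity)
  have h7 : 999 / 1000 * (w t / 3 + 4 * Real.pi / 3 * ρ t)
      ≤ a t / H t ^ 2 * (w t / 3 + 4 * Real.pi / 3 * (ρ t + S t)) := by
    have h8 : 0 ≤ Real.pi * ρ t := by positivity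
    have h9 : 0 ≤ Real.pi * S t := by positivity
    exact mul_le_mul (by linarith) (by linarith) (by linarith) (by linarith)
  have h8 : 0 ≤ Real.pi * ρ t := by positivity
  linarith

/-- The choice of time origin makes `1/H - t` vanish at `t₀`, so its growth, controlled by the
deficit, measures `1 - t H`. -/
theorem deriv_inv_H (h : ShearFlow t₀ H a w ρ S J X) {t : ℝ} (ht : t ∈ Ici t₀) :
    HasDerivWithinAt (fun s => (H s)⁻¹)
      (1 + (w t / 3 + 4 * Real.pi / 3 * (ρ t + S t)) / H t ^ 2) (Ici t₀) t := by
  have hH := (h.H_pos ht).ne'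
  refine ((h.deriv_H t ht).inv hH).congr_deriv ?_
  field_simp
  ring

theorem decel_nonneg (h : ShearFlow t₀ H a w ρ S J X) {t : ℝ} (ht : t ∈ Ici t₀) :
    0 ≤ (w t / 3 + 4 * Real.pi / 3 * (ρ t + S t)) / H t ^ 2 := by
  have hρ := h.rho_nonneg ht
  have hw := h.w_nonneg t ht
  have hS := h.S_nonneg t ht
  positivity

theorem decel_le (h : ShearFlow t₀ H a w ρ S J X) {t : ℝ} (ht : t ∈ Ici t₀) :
    (w t / 3 + 4 * Real.pi / 3 * (ρ t + S t)) / H t ^ 2 ≤ 2 * (1 - a t / H t ^ 2) := by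
  have hH := h.H_pos ht
  rw [div_le_iff₀ (by positivity), mul_assoc, h.deficit_eq ht]
  have h1 := mul_le_mul_of_nonneg_left (h.S_le t ht) Real.pi_pos.le
  have h2 := mul_nonneg Real.pi_pos.le (h.rho_nonneg ht)
  linarith

theorem mul_H_le_one (h : ShearFlow t₀ H a w ρ S J X) {t : ℝ} (ht : t ∈ Ici t₀) :
    t * H t ≤ 1 := by
  have h1 := le_of_hasDerivWithinAt_nonpos (T := t) ht (φ := fun s => s - (H s)⁻¹)
    (fun s hs => (hasDerivWithinAt_id s _).sub (h.deriv_inv_H hs))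
    (fun s hs => by linarith [h.decel_nonneg hs.1])
  simp only [h.init, inv_inv, sub_self, sub_nonpos] at h1
  rw [← le_inv_mul_iff₀' (h.H_pos ht)]
  simpa using h1

theorem H_le (h : ShearFlow t₀ H a w ρ S J X) {t : ℝ} (ht : t ∈ Ici t₀) : H t ≤ t⁻¹ := by
  rw [inv_eq_one_div, le_div_iff₀ (h.time_pos ht), mul_comm]
  exact h.mul_H_le_one ht

theorem one_le_mul_H (h : ShearFlow t₀ H a w ρ S J X) {t c : ℝ} (ht : t ∈ Ici t₀)
    (hy : ∀ s ∈ Icc t₀ t, 1 - a s / H s ^ 2 ≤ c) : 1 ≤ (1 + 2 * c) * (t * H t) := by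
  have h1 := le_of_hasDerivWithinAt_nonpos (T := t) ht (φ := fun s => (H s)⁻¹ - (1 + 2 * c) * s)
    (fun s hs => (h.deriv_inv_H hs).sub ((hasDerivWithinAt_id s _).const_mul _))
    (fun s hs => by linarith [h.decel_le hs.1, hy s hs])
  have hc : 0 ≤ c := (h.deficit_nonneg (mem_Ici.mpr le_rfl)).trans (hy t₀ ⟨le_rfl, ht⟩)
  simp only [h.init, inv_inv] at h1
  have h2 : (H t)⁻¹ ≤ (1 + 2 * c) * t := by nlinarith [mul_nonneg hc h.pos.le]
  rw [inv_le_iff_one_le_mul₀ (h.H_pos ht)] at h2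
  linarith

/-! ### Decay rates for the deficit, the Hubble parameter and the shear. -/

theorem exists_deficit_le (h : ShearFlow t₀ H a w ρ S J X)
    (hy : ∀ t ∈ Ici t₀, 1 - a t / H t ^ 2 ≤ 1 / 1000)
    (hJ : ∀ t ∈ Ici t₀, |J t| ≤ √(a t * (1 / 100)) * ρ t) :
    ∃ C, 0 ≤ C ∧ ∀ t ∈ Ici t₀, 1 - a t / H t ^ 2 ≤ C * t ^ (-(1 / 2) : ℝ) := by
  have h0 := h.deficit_nonneg (mem_Ici.mpr (le_refl t₀))
  have ht₀ := h.pos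
  refine ⟨(1 - a t₀ / H t₀ ^ 2) * t₀ ^ (1 / 2 : ℝ), by positivity, fun t ht => ?_⟩
  have htp := h.time_pos ht
  -- The product `y t^(1/2)` is nonincreasing because `1/2 ≤ (3/4) t H`, as `t H ≥ 1/(1 + 2/1000)`.
  have h1 := le_of_hasDerivWithinAt_nonpos (T := t) ht
    (fun s hs => (h.deriv_deficit hs).mul (hasDerivWithinAt_rpow (h.time_pos hs) (1 / 2) _))
    (fun s hs => by
      have hsp := h.time_pos hs.1
      have d := h.deriv_deficit_le hs.1 (hy s hs.1) (hJ s hs.1)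
      have y0 := h.deficit_nonneg hs.1
      have e : s ^ (1 / 2 : ℝ) = s * s ^ (1 / 2 - 1 : ℝ) := by
        rw [← Real.rpow_one_add' hsp.le (by norm_num)]
        norm_num
      have r : 0 < s ^ (1 / 2 - 1 : ℝ) := by positivity
      have l := h.one_le_mul_H hs.1 fun r hr => hy r hr.1
      generalize 1 - a s / H s ^ 2 = y at *
      rw [e]
      have d2 := mul_le_mul_of_nonneg_right d (mul_nonneg hsp.le r.le)
      have d3 : y * s ^ (1 / 2 - 1 : ℝ) * (1 / 2 - 3 / 4 * (s * H s)) ≤ 0 :=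
        mul_nonpos_of_nonneg_of_nonpos (by positivity) (by linarith)
      linarith)
  simp only [Pi.mul_apply] at h1
  rw [Real.rpow_neg htp.le, ← div_eq_mul_inv, le_div_iff₀ (by positivity)]
  exact h1

theorem one_sub_mul_H_le (h : ShearFlow t₀ H a w ρ S J X) {C : ℝ}
    (hy : ∀ t ∈ Ici t₀, 1 - a t / H t ^ 2 ≤ C * t ^ (-(1 / 2) : ℝ)) (hC : 0 ≤ C) {t : ℝ}
    (ht : t ∈ Ici t₀) : 1 - t * H t ≤ 4 * C * t ^ (-(1 / 2) : ℝ) := by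
  have h1 := le_of_hasDerivWithinAt_nonpos (T := t) ht
    (φ := fun s => (H s)⁻¹ - s - 4 * C * s ^ (1 / 2 : ℝ))
    (fun s hs => ((h.deriv_inv_H hs).sub (hasDerivWithinAt_id s _)).sub
      ((hasDerivWithinAt_rpow (h.time_pos hs) (1 / 2) _).const_mul _))
    (fun s hs => by
      have e : (1 / 2 - 1 : ℝ) = -(1 / 2) := by norm_num
      rw [e]
      linarith [h.decel_le hs.1, hy s hs.1])
  simp only [h.init, inv_inv] at h1
  have htp := h.time_pos ht
  have hH := h.H_pos ht
  have ht₀ := h.pos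
  have h2 : (H t)⁻¹ - t ≤ 4 * C * t ^ (1 / 2 : ℝ) := by
    have : 0 ≤ C * t₀ ^ (1 / 2 : ℝ) := by positivity
    linarith
  have e : t ^ (1 / 2 : ℝ) = t * t ^ (-(1 / 2) : ℝ) := by
    rw [← Real.rpow_one_add' htp.le (by norm_num)]
    norm_num
  have h3 : 1 - t * H t = ((H t)⁻¹ - t) * H t := by field_simp
  have h4 : 0 ≤ C * t ^ (-(1 / 2) : ℝ) := by positivity
  calc 1 - t * H t = ((H t)⁻¹ - t) * H t := h3
    _ ≤ 4 * C * t ^ (1 / 2 : ℝ) * H t := mul_le_mul_of_nonneg_right h2 hH.le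
    _ = 4 * (C * t ^ (-(1 / 2) : ℝ)) * (t * H t) := by rw [e]; ring
    _ ≤ 4 * (C * t ^ (-(1 / 2) : ℝ)) * 1 :=
      mul_le_mul_of_nonneg_left (h.mul_H_le_one ht) (by positivity)
    _ = 4 * C * t ^ (-(1 / 2) : ℝ) := by ring

/-- The natural rate is `t^(-3/2)`; it is weakened to `t^(-5/4)`, the rate available for `√w`, so
that one Gronwall lemma serves all quantities. -/
theorem inv_sub_H_le (h : ShearFlow t₀ H a w ρ S J X) {C : ℝ}
    (hy : ∀ t ∈ Ici t₀, 1 - a t / H t ^ 2 ≤ C * t ^ (-(1 / 2) : ℝ)) (hC : 0 ≤ C) {t : ℝ}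
    (ht : t ∈ Ici t₀) :
    t⁻¹ - H t ≤ 4 * C * t₀ ^ (-(1 / 4) : ℝ) * t ^ (-(5 / 4) : ℝ) := by
  have htp := h.time_pos ht
  have h1 := h.one_sub_mul_H_le hy hC ht
  have h2 : t ^ (-(1 / 4) : ℝ) ≤ t₀ ^ (-(1 / 4) : ℝ) :=
    Real.rpow_le_rpow_of_nonpos h.pos ht (by norm_num)
  have e : t ^ (-(1 / 2) : ℝ) = t * (t ^ (-(1 / 4) : ℝ) * t ^ (-(5 / 4) : ℝ)) := by
    rw [← Real.rpow_add htp, ← Real.rpow_one_add' htp.le (by norm_num)]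
    norm_num
  have h3 : t⁻¹ - H t = (1 - t * H t) / t := by field_simp
  rw [h3, div_le_iff₀ htp]
  refine h1.trans ?_
  rw [e]
  have h4 : 0 ≤ C * t * t ^ (-(5 / 4) : ℝ) := by positivity
  nlinarith

theorem sqrt_w_le_rpow (h : ShearFlow t₀ H a w ρ S J X) {C : ℝ}
    (hy : ∀ t ∈ Ici t₀, 1 - a t / H t ^ 2 ≤ C * t ^ (-(1 / 2) : ℝ)) (hC : 0 ≤ C) {t : ℝ}
    (ht : t ∈ Ici t₀) : √(w t) ≤ √(6 * C) * t ^ (-(5 / 4) : ℝ) := by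
  have htp := h.time_pos ht
  have h1 := h.sqrt_w_le ht (c := √(6 * C) * t ^ (-(1 / 4) : ℝ)) (by positivity) (by
    have e : (t ^ (-(1 / 4) : ℝ)) ^ 2 = t ^ (-(1 / 2) : ℝ) := by
      rw [← Real.rpow_natCast, ← Real.rpow_mul htp.le]
      norm_num
    rw [mul_pow, Real.sq_sqrt (by positivity), e]
    linarith [hy t ht])
  refine h1.trans ?_
  have e : t ^ (-(5 / 4) : ℝ) = t ^ (-(1 / 4) : ℝ) * t⁻¹ := by
    rw [← Real.rpow_neg_one, ← Real.rpow_add htp]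
    norm_num
  rw [e, ← mul_assoc]
  exact mul_le_mul_of_nonneg_left (h.H_le ht) (by positivity)

theorem supersolution_rpow (h : ShearFlow t₀ H a w ρ S J X)
    (hy : ∀ t ∈ Ici t₀, 1 - a t / H t ^ 2 ≤ 1 / 1000) {t : ℝ} (ht : t ∈ Ici t₀) :
    7 / 4 * t⁻¹ < 2 * (H t - √(w t)) := by
  have htp := h.time_pos ht
  -- `31/400` is just above `√(6/1000)`; together with `t H ≥ 1/1.002` it leaves `2 (H - √w)` above
  -- `(7/4)/t`.
  have h1 := h.sqrt_w_le ht (c := 31 / 400) (by norm_num) (by linarith [hy t ht])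
  have h2 := h.one_le_mul_H ht fun s hs => hy s hs.1
  have h3 : t⁻¹ ≤ (1 + 2 * (1 / 1000)) * H t := by
    rw [inv_le_iff_one_le_mul₀ htp]
    linarith
  linarith [h.H_pos ht]

theorem exists_shear_bound (h : ShearFlow t₀ H a w ρ S J X) {C : ℝ}
    (hy : ∀ t ∈ Ici t₀, 1 - a t / H t ^ 2 ≤ C * t ^ (-(1 / 2) : ℝ)) (hC : 0 ≤ C) {B : ℝ}
    (hB : 0 ≤ B) (hS : ∀ t ∈ Ici t₀, S t ≤ B * t ^ (-(7 / 4) : ℝ) * ρ t) :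
    ∃ M, ∀ t ∈ Ici t₀, t ^ 4 * (w t / H t ^ 2) ≤ M := by
  -- Vacuum shear obeys `(w/H²)' ≈ -4 H (w/H²)`, so the weight `t^4` cancels the leading term and
  -- leaves `1/t - H`, the deceleration and the stress.
  have hd : ∀ t ∈ Ici t₀, HasDerivWithinAt (fun s => s ^ 4 * (w s / H s ^ 2))
      (t ^ 4 * (w t / H t ^ 2) * (4 * (t⁻¹ - H t)
          + 2 * ((w t / 3 + 4 * Real.pi / 3 * (ρ t + S t)) / H t ^ 2) * H t)
        - t ^ 4 * (16 * Real.pi * X t / H t ^ 2)) (Ici t₀) t := by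
    intro t ht
    have hH := (h.H_pos ht).ne'
    have htp := (h.time_pos ht).ne'
    refine (((hasDerivWithinAt_id t _).pow 4).mul
      ((h.deriv_w t ht).div ((h.deriv_H t ht).pow 2) (pow_ne_zero 2 hH))).congr_deriv ?_
    simp only [Pi.pow_apply, Pi.div_apply, id]
    field_simp
    ring
  refine exists_bound_of_deriv_le (C := 20 * C * t₀ ^ (-(1 / 4) : ℝ) + 6 * C * B) h.pos hd
    (fun t ht => ?_) fun t ht => ?_
  · have := h.w_nonneg t ht
    positivity
  have htp := h.time_pos ht
  have hH := h.H_pos ht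
  have ht₀ := h.pos
  set Q := t ^ 4 * (w t / H t ^ 2) with hQ
  have hQ0 : 0 ≤ Q := by
    have := h.w_nonneg t ht
    positivity
  have h1 := h.inv_sub_H_le hy hC ht
  have hdec : (w t / 3 + 4 * Real.pi / 3 * (ρ t + S t)) / H t ^ 2 * H t
      ≤ 2 * C * t₀ ^ (-(1 / 4) : ℝ) * t ^ (-(5 / 4) : ℝ) := by
    have h2 : t ^ (-(1 / 4) : ℝ) ≤ t₀ ^ (-(1 / 4) : ℝ) :=
      Real.rpow_le_rpow_of_nonpos h.pos ht (by norm_num)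
    have e : t ^ (-(1 / 2) : ℝ) * t⁻¹ = t ^ (-(1 / 4) : ℝ) * t ^ (-(5 / 4) : ℝ) := by
      rw [← Real.rpow_neg_one, ← Real.rpow_add htp, ← Real.rpow_add htp]
      norm_num
    calc _ ≤ 2 * (C * t ^ (-(1 / 2) : ℝ)) * t⁻¹ :=
          mul_le_mul ((h.decel_le ht).trans (by linarith [hy t ht])) (h.H_le ht) hH.le
            (by positivity)
      _ = 2 * C * (t ^ (-(1 / 2) : ℝ) * t⁻¹) := by ring
      _ = 2 * C * (t ^ (-(1 / 4) : ℝ) * t ^ (-(5 / 4) : ℝ)) := by rw [e]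
      _ ≤ 2 * C * (t₀ ^ (-(1 / 4) : ℝ) * t ^ (-(5 / 4) : ℝ)) := by gcongr
      _ = _ := by ring
  -- Power count: `|X| ≤ √w S`, with `S/ρ` of order `t^(-7/4)`, `ρ/H²` of order `t^(-1/2)` and `H ≤
  -- 1/t`, leaves `t^(-5/4) √Q`, and `√Q ≤ 1 + Q`.
  have hX : -(t ^ 4 * (16 * Real.pi * X t / H t ^ 2)) ≤ 6 * C * B * t ^ (-(5 / 4) : ℝ) * (1 + Q) := by
    have hw := Real.sqrt_nonneg (w t)
    have hsq : (t ^ 2 * (√(w t) / H t)) ^ 2 = Q := by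
      rw [mul_pow, div_pow, Real.sq_sqrt (h.w_nonneg t ht)]
      ring
    have hx : t ^ 2 * (√(w t) / H t) ≤ 1 + Q := by
      nlinarith [sq_nonneg (t ^ 2 * (√(w t) / H t) - 1), sq_nonneg (t ^ 2 * (√(w t) / H t))]
    have hpi := Real.pi_pos
    have hr : 16 * Real.pi * ρ t / H t ^ 2 ≤ 6 * (C * t ^ (-(1 / 2) : ℝ)) := by
      rw [div_le_iff₀ (by positivity)]
      have k1 := h.deficit_eq ht
      have k2 := mul_le_mul_of_nonneg_right (hy t ht) (sq_nonneg (H t))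
      have k3 := h.w_nonneg t ht
      linarith
    have hX1 : -X t ≤ √(w t) * (B * t ^ (-(7 / 4) : ℝ) * ρ t) :=
      (neg_le_abs _).trans ((h.abs_X_le t ht).trans (mul_le_mul_of_nonneg_left (hS t ht) hw))
    have e : t ^ 4 * t⁻¹ * t ^ (-(7 / 4) : ℝ) * t ^ (-(1 / 2) : ℝ)
        = t ^ 2 * t ^ (-(5 / 4) : ℝ) := by
      rw [← Real.rpow_natCast t 4, ← Real.rpow_natCast t 2, ← Real.rpow_neg_one,
        ← Real.rpow_add htp, ← Real.rpow_add htp, ← Real.rpow_add htp, ← Real.rpow_add htp]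
      norm_num
    calc -(t ^ 4 * (16 * Real.pi * X t / H t ^ 2))
        = t ^ 4 * (16 * Real.pi / H t ^ 2) * (-X t) := by ring
      _ ≤ t ^ 4 * (16 * Real.pi / H t ^ 2) * (√(w t) * (B * t ^ (-(7 / 4) : ℝ) * ρ t)) :=
          mul_le_mul_of_nonneg_left hX1 (by positivity)
      _ = t ^ 4 * √(w t) * B * t ^ (-(7 / 4) : ℝ) * (16 * Real.pi * ρ t / H t ^ 2) := by ring
      _ ≤ t ^ 4 * √(w t) * B * t ^ (-(7 / 4) : ℝ) * (6 * (C * t ^ (-(1 / 2) : ℝ))) :=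
          mul_le_mul_of_nonneg_left hr (by positivity)
      _ = 6 * C * B * t ^ 4 * (√(w t) / H t) * t ^ (-(7 / 4) : ℝ) * t ^ (-(1 / 2) : ℝ) * H t := by
          field_simp
      _ ≤ 6 * C * B * t ^ 4 * (√(w t) / H t) * t ^ (-(7 / 4) : ℝ) * t ^ (-(1 / 2) : ℝ) * t⁻¹ :=
          mul_le_mul_of_nonneg_left (h.H_le ht) (by positivity)
      _ = 6 * C * B * (√(w t) / H t)
            * (t ^ 4 * t⁻¹ * t ^ (-(7 / 4) : ℝ) * t ^ (-(1 / 2) : ℝ)) := by ring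
      _ = 6 * C * B * t ^ (-(5 / 4) : ℝ) * (t ^ 2 * (√(w t) / H t)) := by
          rw [e]
          ring
      _ ≤ 6 * C * B * t ^ (-(5 / 4) : ℝ) * (1 + Q) :=
          mul_le_mul_of_nonneg_left hx (by positivity)
  have hm : Q * (4 * (t⁻¹ - H t)
      + 2 * ((w t / 3 + 4 * Real.pi / 3 * (ρ t + S t)) / H t ^ 2) * H t)
      ≤ Q * (20 * C * t₀ ^ (-(1 / 4) : ℝ) * t ^ (-(5 / 4) : ℝ)) :=
    mul_le_mul_of_nonneg_left (by linarith) hQ0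
  have hp : 0 ≤ 20 * C * t₀ ^ (-(1 / 4) : ℝ) * t ^ (-(5 / 4) : ℝ) := by positivity
  linarith

/-- A nonnegative quantity that grows at most like `exp (∫ 2 (H + √w))` is `O(t²)`. -/
theorem exists_bound_div_sq (h : ShearFlow t₀ H a w ρ S J X) {C : ℝ}
    (hy : ∀ t ∈ Ici t₀, 1 - a t / H t ^ 2 ≤ C * t ^ (-(1 / 2) : ℝ)) (hC : 0 ≤ C) {u u' : ℝ → ℝ}
    (hu : ∀ t ∈ Ici t₀, HasDerivWithinAt u (u' t) (Ici t₀) t) (h0 : ∀ t ∈ Ici t₀, 0 ≤ u t)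
    (hle : ∀ t ∈ Ici t₀, u' t ≤ 2 * H t * u t + 2 * √(w t) * u t) :
    ∃ M, ∀ t ∈ Ici t₀, u t / t ^ 2 ≤ M := by
  have hd : ∀ t ∈ Ici t₀, HasDerivWithinAt (fun s => u s / s ^ 2)
      (u' t / t ^ 2 - 2 * t⁻¹ * (u t / t ^ 2)) (Ici t₀) t := by
    intro t ht
    have htp := (h.time_pos ht).ne'
    refine ((hu t ht).div ((hasDerivWithinAt_id t _).pow 2) (pow_ne_zero 2 htp)).congr_deriv ?_
    simp only [Pi.pow_apply, id]
    field_simp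
    ring
  refine exists_bound_of_deriv_le (C := 2 * √(6 * C)) h.pos hd
    (fun t ht => div_nonneg (h0 t ht) (sq_nonneg t)) fun t ht => ?_
  have htp := h.time_pos ht
  have h1 := h.sqrt_w_le_rpow hy hC ht
  have h2 := h.H_le ht
  have h3 := div_nonneg (h0 t ht) (sq_nonneg t)
  have h4 : u' t / t ^ 2 ≤ (2 * H t + 2 * √(w t)) * (u t / t ^ 2) := by
    rw [← mul_div_assoc]
    exact div_le_div_of_nonneg_right (by linarith [hle t ht]) (sq_nonneg t)
  have h5 : (2 * H t + 2 * √(w t)) * (u t / t ^ 2)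
      ≤ (2 * t⁻¹ + 2 * (√(6 * C) * t ^ (-(5 / 4) : ℝ))) * (u t / t ^ 2) :=
    mul_le_mul_of_nonneg_right (by linarith) h3
  have h6 : 0 ≤ √(6 * C) * t ^ (-(5 / 4) : ℝ) := by positivity
  linarith

/-- A nonnegative quantity that decays at least like `exp (-∫ 2 (H - √w))` is `O(t⁻²)`. -/
theorem exists_bound_mul_sq (h : ShearFlow t₀ H a w ρ S J X) {C : ℝ}
    (hy : ∀ t ∈ Ici t₀, 1 - a t / H t ^ 2 ≤ C * t ^ (-(1 / 2) : ℝ)) (hC : 0 ≤ C) {u u' : ℝ → ℝ}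
    (hu : ∀ t ∈ Ici t₀, HasDerivWithinAt u (u' t) (Ici t₀) t) (h0 : ∀ t ∈ Ici t₀, 0 ≤ u t)
    (hle : ∀ t ∈ Ici t₀, u' t ≤ -2 * H t * u t + 2 * √(w t) * u t) :
    ∃ M, ∀ t ∈ Ici t₀, t ^ 2 * u t ≤ M := by
  have hd : ∀ t ∈ Ici t₀, HasDerivWithinAt (fun s => s ^ 2 * u s)
      (t ^ 2 * u' t + 2 * t⁻¹ * (t ^ 2 * u t)) (Ici t₀) t := by
    intro t ht
    have htp := (h.time_pos ht).ne'
    refine (((hasDerivWithinAt_id t _).pow 2).mul (hu t ht)).congr_deriv ?_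
    simp only [Pi.pow_apply, id]
    field_simp
    ring
  refine exists_bound_of_deriv_le (C := 8 * C * t₀ ^ (-(1 / 4) : ℝ) + 2 * √(6 * C)) h.pos hd
    (fun t ht => mul_nonneg (sq_nonneg t) (h0 t ht)) fun t ht => ?_
  have htp := h.time_pos ht
  have ht₀ := h.pos
  have h1 := h.sqrt_w_le_rpow hy hC ht
  have h2 := h.inv_sub_H_le hy hC ht
  have h3 := mul_nonneg (sq_nonneg t) (h0 t ht)
  have h4 : t ^ 2 * u' t ≤ (-2 * H t + 2 * √(w t)) * (t ^ 2 * u t) := by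
    have := mul_le_mul_of_nonneg_left (hle t ht) (sq_nonneg t)
    linarith
  have h5 : (2 * (t⁻¹ - H t) + 2 * √(w t)) * (t ^ 2 * u t)
      ≤ ((8 * C * t₀ ^ (-(1 / 4) : ℝ) + 2 * √(6 * C)) * t ^ (-(5 / 4) : ℝ)) * (t ^ 2 * u t) :=
    mul_le_mul_of_nonneg_right (by linarith) h3
  have h6 : 0 ≤ (8 * C * t₀ ^ (-(1 / 4) : ℝ) + 2 * √(6 * C)) * t ^ (-(5 / 4) : ℝ) := by
    positivity
  linarith

end ShearFlow

/-! ### Frame components of the shear -/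

theorem mulVec_single_dot (M : Mat) (i : Fin 3) (v : Mom) :
    (Pi.single i 1 : Mom) ⬝ᵥ M.mulVec v = M.mulVec v i := by
  rw [single_one_dotProduct]

theorem dot_mulVec_comm {M : Mat} (hM : M.IsSymm) (p q : Mom) :
    q ⬝ᵥ M.mulVec p = p ⬝ᵥ M.mulVec q := by
  rw [Matrix.dotProduct_mulVec, ← Matrix.mulVec_transpose, hM.eq, dotProduct_comm]

theorem quad_single (M : Mat) (i : Fin 3) : quad M (Pi.single i 1) = M i i := by
  rw [quad_eq, mulVec_single_dot]
  simp

theorem quad_inv_mulVec_single {g : Mat} (hg : g.PosDef) (X : Mat) (i : Fin 3) :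
    quad (g⁻¹ * X * g⁻¹) (g.mulVec (Pi.single i 1)) = X i i := by
  rw [quad_eq, Matrix.mulVec_mulVec, Matrix.mul_assoc, inv_mul_of_posDef hg, Matrix.mul_one,
    ← Matrix.mulVec_mulVec, ← dot_mulVec_comm (isSymm_inv hg), Matrix.mulVec_mulVec,
    inv_mul_of_posDef hg, Matrix.one_mulVec, dotProduct_comm, mulVec_single_dot]
  simp

theorem quad_inv_lower {g : Mat} (hg : g.PosDef) (i : Fin 3) :
    quad g⁻¹ (g.mulVec (Pi.single i 1)) = g i i := by
  have h := quad_inv_mulVec_single hg g i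
  rwa [inv_mul_of_posDef hg, Matrix.one_mul] at h

theorem abs_apply_diag_le {g X : Mat} (hg : g.PosDef) (hX : X.IsSymm) (i : Fin 3) :
    |X i i| ≤ √(g⁻¹ * X * (g⁻¹ * X)).trace * g i i := by
  have h := abs_quad_le hg.inv hX (g.mulVec (Pi.single i 1))
  rwa [quad_inv_mulVec_single hg, quad_inv_lower hg] at h

theorem abs_inv_apply_diag_le {g X : Mat} (hg : g.PosDef) (hX : X.IsSymm) (i : Fin 3) :
    |(g⁻¹ * X * g⁻¹) i i| ≤ √(g⁻¹ * X * (g⁻¹ * X)).trace * g⁻¹ i i := by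
  have h := abs_quad_le hg.inv hX (Pi.single i 1)
  rwa [quad_single, quad_single] at h

/-- Polarization of the quadratic form bound at `p = s e_i` and `q = s⁻¹ g e_j`. The free scale `s`
balances `g^ii` against `g_jj`; in the application `s = t`, and both terms stay bounded. -/
theorem abs_mixed_apply_le {g X : Mat} (hg : g.PosDef) (hX : X.IsSymm) {s : ℝ} (hs : 0 < s)
    (i j : Fin 3) :
    |(g⁻¹ * X) i j| ≤ 1 / 2 * √(g⁻¹ * X * (g⁻¹ * X)).trace * (s ^ 2 * g⁻¹ i i + g j j / s ^ 2) := by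
  have hG := isSymm_inv hg
  have hM : (g⁻¹ * X * g⁻¹).IsSymm := by
    rw [Matrix.IsSymm, Matrix.transpose_mul, Matrix.transpose_mul, hG.eq, hX.eq, Matrix.mul_assoc]
  set p : Mom := s • Pi.single i 1 with hp
  set q : Mom := s⁻¹ • g.mulVec (Pi.single j 1) with hq
  have e1 : p ⬝ᵥ (g⁻¹ * X * g⁻¹).mulVec q = (g⁻¹ * X) i j := by
    rw [hp, hq, Matrix.mulVec_smul, smul_dotProduct, dotProduct_smul, smul_smul,
      mul_inv_cancel₀ hs.ne', one_smul, Matrix.mulVec_mulVec, Matrix.mul_assoc,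
      inv_mul_of_posDef hg, Matrix.mul_one, mulVec_single_dot]
    simp
  have hpol : quad (g⁻¹ * X * g⁻¹) (p + q) - quad (g⁻¹ * X * g⁻¹) (p - q)
      = 4 * (g⁻¹ * X) i j := by
    simp only [quad_eq, Matrix.mulVec_add, Matrix.mulVec_sub, add_dotProduct, dotProduct_add,
      sub_dotProduct, dotProduct_sub, dot_mulVec_comm hM p q, e1]
    ring
  have hpar : quad g⁻¹ (p + q) + quad g⁻¹ (p - q) = 2 * (s ^ 2 * g⁻¹ i i + g j j / s ^ 2) := by
    have e2 : quad g⁻¹ p = s ^ 2 * g⁻¹ i i := by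
      rw [← quad_single g⁻¹ i]
      simp only [quad_eq, hp, Matrix.mulVec_smul, smul_dotProduct, dotProduct_smul, smul_eq_mul]
      ring
    have e3 : quad g⁻¹ q = g j j / s ^ 2 := by
      rw [← quad_inv_lower hg j]
      simp only [quad_eq, hq, Matrix.mulVec_smul, smul_dotProduct, dotProduct_smul, smul_eq_mul]
      field_simp
    rw [← e2, ← e3]
    simp only [quad_eq, Matrix.mulVec_add, Matrix.mulVec_sub, add_dotProduct, dotProduct_add,
      sub_dotProduct, dotProduct_sub]
    ring
  have b1 := abs_le.mp (abs_quad_le hg.inv hX (p + q))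
  have b2 := abs_le.mp (abs_quad_le hg.inv hX (p - q))
  have hsum : √(g⁻¹ * X * (g⁻¹ * X)).trace * quad g⁻¹ (p + q)
      + √(g⁻¹ * X * (g⁻¹ * X)).trace * quad g⁻¹ (p - q)
      = √(g⁻¹ * X * (g⁻¹ * X)).trace * (2 * (s ^ 2 * g⁻¹ i i + g j j / s ^ 2)) := by
    rw [← mul_add, hpar]
  rw [abs_le]
  constructor <;> linarith [b1.1, b1.2, b2.1, b2.2]

theorem varA_eq {g : Mat} (hg : g.PosDef) (k : Mat) : varA g k = g⁻¹ 0 0 / hubble g k ^ 2 := by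
  rw [varA, scalarR_structV hg, show -(-6 * g⁻¹ 0 0) = 6 * g⁻¹ 0 0 by ring,
    mul_div_mul_left _ _ (by norm_num)]

theorem shearNorm_eq {g k : Mat} (hH : 0 < hubble g k) :
    shearNorm g k = √(shearSq g k) / hubble g k := by
  have e : (Shear g k * Shear g k).trace = shearSq g k / hubble g k ^ 2 := by
    simp only [Shear, mixed, Matrix.smul_mul, Matrix.mul_smul, smul_smul, Matrix.trace_smul,
      smul_eq_mul, shearSq]
    field_simp
  rw [shearNorm, e, Real.sqrt_div' _ (sq_nonneg _), Real.sqrt_sq hH.le]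

theorem abs_shear_apply_le {g k : Mat} (hg : g.PosDef) (hk : k.IsSymm) (hH : 0 < hubble g k)
    {s : ℝ} (hs : 0 < s) (i j : Fin 3) :
    |Shear g k i j| ≤ 1 / 2 * (√(shearSq g k) / hubble g k)
      * (s ^ 2 * g⁻¹ i i + g j j / s ^ 2) := by
  have h := abs_mixed_apply_le hg (sigma_isSymm hg hk) hs i j
  rw [Shear, Matrix.smul_apply, smul_eq_mul, abs_mul, abs_of_pos (inv_pos.mpr hH), mixed,
    inv_mul_le_iff₀ hH]
  refine h.trans_eq ?_
  rw [← shearSq]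
  field_simp

/-! ### Bianchi type V solutions with small data -/

namespace IsBianchiV

variable {t₀ : ℝ} {g k : ℝ → Mat} {f : ℝ → Mom → ℝ}

theorem shearFlow (h : IsBianchiV t₀ g k f) :
    ShearFlow t₀ (fun t => hubble (g t) (k t)) (fun t => (g t)⁻¹ 0 0)
      (fun t => shearSq (g t) (k t)) (fun t => rho (g t) (f t))
      (fun t => trg (g t) (stress (g t) (f t))) (fun t => currentUp (g t) (f t))
      (fun t => shearStress (g t) (k t) (f t)) where
  pos := by
    rw [h.origin]
    exact div_pos_of_neg_of_neg (by norm_num) h.expanding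
  init := by
    have e : t₀⁻¹ = (-3 / trg (g t₀) (k t₀))⁻¹ := congrArg _ h.origin
    rw [e, hubble, inv_div]
    ring
  a_pos t ht := (h.solution.posDef t ht).inv.diag_pos
  w_nonneg t ht := trace_sq_nonneg (h.solution.posDef t ht).inv.posSemidef
    (sigma_isSymm (h.solution.posDef t ht) (h.solution.k_isSymm ht))
  S_nonneg t ht := trg_stress_nonneg (h.solution.posDef t ht) (h.solution.continuous_f ht)
    (h.solution.compactSupp t ht) (h.solution.f_nonneg t ht)
  S_le t ht := trg_stress_le_rho (h.solution.posDef t ht) (h.solution.continuous_f ht)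
    (h.solution.compactSupp t ht) (h.solution.f_nonneg t ht)
  abs_X_le t ht := abs_sum_mul_stress_le (h.solution.posDef t ht) (h.solution.continuous_f ht)
    (h.solution.compactSupp t ht) (h.solution.f_nonneg t ht)
    (sigma_isSymm (h.solution.posDef t ht) (h.solution.k_isSymm ht))
  constraint t ht := h.solution.hamiltonian_shearSq ht
  deriv_H t ht := h.solution.hasDerivWithinAt_hubble ht
  deriv_a t ht := h.solution.hasDerivWithinAt_inv_zero ht
  deriv_w t ht := h.solution.hasDerivWithinAt_shearSq ht

theorem normSq_lt_of_deficit_le (h : IsBianchiV t₀ g k f) {T B : ℝ} (hB : 0 < B)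
    (h0 : ∀ p, f t₀ p ≠ 0 → normSq (g t₀) p < B)
    (hy : ∀ s ∈ Icc t₀ T, 1 - (g s)⁻¹ 0 0 / hubble (g s) (k s) ^ 2 ≤ 1 / 1000) {t : ℝ}
    (ht : t ∈ Icc t₀ T) (p : Mom) (hp : f t p ≠ 0) : normSq (g t) p < B := by
  have hF := h.shearFlow
  refine h.solution.normSq_lt_of_ne_zero (B := fun _ => B) (B' := fun _ => 0)
    (fun s _ => hasDerivWithinAt_const s _ B) (fun _ _ => hB) (fun s hs => ?_) h0 ht p hp
  -- With `√w ≤ H/2` even a constant is a strict supersolution for `|p|²`.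
  have h1 := hF.sqrt_w_le hs.1 (c := 1 / 2) (by norm_num) (by linarith [hy s hs])
  have h2 := hF.H_pos hs.1
  have h3 : 0 < (hubble (g s) (k s) - √(shearSq (g s) (k s))) * B :=
    mul_pos (by linarith) hB
  linarith

theorem abs_current_le (h : IsBianchiV t₀ g k f) {t B : ℝ} (ht : t ∈ Ici t₀) (hB : B ≤ 1 / 100)
    (hN : ∀ p, f t p ≠ 0 → normSq (g t) p < B) :
    |currentUp (g t) (f t)| ≤ √((g t)⁻¹ 0 0 * (1 / 100)) * rho (g t) (f t) :=
  abs_sum_mul_current_le (h.solution.posDef t ht) (h.solution.continuous_f ht)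
    (h.solution.compactSupp t ht) (h.solution.f_nonneg t ht) (fun p hp => (hN p hp).le.trans hB) 0

/-- The bootstrap: a small deficit keeps the momenta below their initial bound, small momenta bound
the current, and then the deficit cannot grow. -/
theorem deficit_le_init (h : IsBianchiV t₀ g k f) {B : ℝ} (hB : 0 < B) (hB' : B ≤ 1 / 100)
    (h0 : ∀ p, f t₀ p ≠ 0 → normSq (g t₀) p < B)
    (hy : 1 - (g t₀)⁻¹ 0 0 / hubble (g t₀) (k t₀) ^ 2 < 1 / 1000) {t : ℝ} (ht : t ∈ Ici t₀) :
    1 - (g t)⁻¹ 0 0 / hubble (g t) (k t) ^ 2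
      ≤ 1 - (g t₀)⁻¹ 0 0 / hubble (g t₀) (k t₀) ^ 2 := by
  have hF := h.shearFlow
  refine le_init_of_bootstrap hF.continuousOn_deficit hy (fun T hT hs => ?_) ht
  refine le_of_hasDerivWithinAt_nonpos hT (fun s hs' => hF.deriv_deficit hs') fun s hs' => ?_
  refine (hF.deriv_deficit_le hs'.1 (hs s hs') (h.abs_current_le hs'.1 hB' fun p hp =>
    h.normSq_lt_of_deficit_le hB h0 hs hs' p hp)).trans ?_
  have h1 := mul_nonneg (hF.H_pos hs'.1).le (hF.deficit_nonneg hs'.1)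
  linarith

theorem small_data_bounds (h : IsBianchiV t₀ g k f) {δ : ℝ} (hd : SmallData δ (g t₀) (k t₀) (f t₀))
    (hδ : δ ≤ 1 / 1000) :
    (∀ t ∈ Ici t₀, 1 - (g t)⁻¹ 0 0 / hubble (g t) (k t) ^ 2 < δ) ∧
      ∀ t ∈ Ici t₀, ∀ p, f t p ≠ 0 → normSq (g t) p < δ ^ 2 := by
  have ht₀ : t₀ ∈ Ici t₀ := mem_Ici.mpr le_rfl
  have hδ0 : 0 < δ := (abs_nonneg _).trans_lt hd.plus
  have hy : 1 - (g t₀)⁻¹ 0 0 / hubble (g t₀) (k t₀) ^ 2 < δ := by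
    have := hd.curvature
    rw [varA_eq (h.solution.posDef t₀ ht₀)] at this
    linarith [neg_le_abs ((g t₀)⁻¹ 0 0 / hubble (g t₀) (k t₀) ^ 2 - 1)]
  have h0 : ∀ p, f t₀ p ≠ 0 → normSq (g t₀) p < δ ^ 2 := fun p hp =>
    (Real.sqrt_lt' hδ0).mp
      ((sqrt_normSq_le_supMom (h.solution.compactSupp t₀ ht₀) hp).trans_lt hd.momenta)
  have hle : ∀ t ∈ Ici t₀, 1 - (g t)⁻¹ 0 0 / hubble (g t) (k t) ^ 2 < δ := fun t ht =>
    (h.deficit_le_init (B := δ ^ 2) (by positivity) (by nlinarith) h0 (hy.trans_le hδ) ht).trans_lt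
      hy
  exact ⟨hle, fun t ht p hp => h.normSq_lt_of_deficit_le (by positivity) h0
    (fun s hs => (hle s hs.1).le.trans hδ) ⟨ht, le_rfl⟩ p hp⟩

theorem exists_normSq_decay (h : IsBianchiV t₀ g k f)
    (hy : ∀ t ∈ Ici t₀, 1 - (g t)⁻¹ 0 0 / hubble (g t) (k t) ^ 2 ≤ 1 / 1000) :
    ∃ B, 0 < B ∧ ∀ t ∈ Ici t₀, ∀ p, f t p ≠ 0 → normSq (g t) p ≤ B * t ^ (-(7 / 4) : ℝ) := by
  have hF := h.shearFlow
  have ht₀ := hF.pos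
  obtain ⟨P, hP⟩ : ∃ P, ∀ p, f t₀ p ≠ 0 → normSq (g t₀) p < P := by
    refine ⟨supMom (g t₀) (f t₀) ^ 2 + 1, fun p hp => ?_⟩
    have h1 := sqrt_normSq_le_supMom (g := g t₀) (h.solution.compactSupp t₀ (mem_Ici.mpr le_rfl)) hp
    have h2 := (Real.sqrt_le_left supMom_nonneg).mp h1
    linarith
  have hPm : ∀ p, f t₀ p ≠ 0 → normSq (g t₀) p < |P| + 1 := fun p hp => by
    linarith [hP p hp, le_abs_self P]
  refine ⟨(|P| + 1) * t₀ ^ (7 / 4 : ℝ), by positivity, fun t ht p hp => ?_⟩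
  refine (h.solution.normSq_lt_of_ne_zero (T := t)
    (B := fun s => (|P| + 1) * t₀ ^ (7 / 4 : ℝ) * s ^ (-(7 / 4) : ℝ))
    (fun s hs => (hasDerivWithinAt_rpow (hF.time_pos hs) _ _).const_mul _)
    (fun s hs => ?_) (fun s hs => ?_) ?_ ⟨ht, le_rfl⟩ p hp).le
  · have := hF.time_pos hs.1
    positivity
  · have hsp := hF.time_pos hs.1
    have e : s ^ (-(7 / 4) - 1 : ℝ) = s⁻¹ * s ^ (-(7 / 4) : ℝ) := by
      rw [← Real.rpow_neg_one, ← Real.rpow_add hsp]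
      norm_num
    have h1 := hF.supersolution_rpow hy hs.1
    have h2 : 0 < (|P| + 1) * t₀ ^ (7 / 4 : ℝ) * s ^ (-(7 / 4) : ℝ) := by positivity
    have h3 := mul_lt_mul_of_pos_right h1 h2
    rw [e]
    linarith
  · have e : (|P| + 1) * t₀ ^ (7 / 4 : ℝ) * t₀ ^ (-(7 / 4) : ℝ) = |P| + 1 := by
      rw [mul_assoc, ← Real.rpow_add ht₀]
      norm_num
    simp only [e]
    exact hPm

theorem exists_shear_decay (h : IsBianchiV t₀ g k f) {C : ℝ} (hC : 0 ≤ C)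
    (hy : ∀ t ∈ Ici t₀, 1 - (g t)⁻¹ 0 0 / hubble (g t) (k t) ^ 2 ≤ C * t ^ (-(1 / 2) : ℝ))
    {B : ℝ} (hB : 0 < B)
    (hN : ∀ t ∈ Ici t₀, ∀ p, f t p ≠ 0 → normSq (g t) p ≤ B * t ^ (-(7 / 4) : ℝ)) (i j : Fin 3) :
    ∃ M, ∀ t ∈ Ici t₀, |Shear (g t) (k t) i j| ≤ M * t ^ (-2 : ℝ) := by
  have hF := h.shearFlow
  have hs := h.solution
  obtain ⟨M, hM⟩ := hF.exists_shear_bound hy hC hB.le fun t ht =>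
    trg_stress_le_mul_rho (hs.posDef t ht) (hs.continuous_f ht) (hs.compactSupp t ht)
      (hs.f_nonneg t ht) (hN t ht)
  obtain ⟨M₁, hM₁⟩ := hF.exists_bound_mul_sq hy hC (fun t ht => hs.hasDerivWithinAt_inv_diag ht i)
    (fun t ht => (hs.posDef t ht).inv.diag_pos.le) (fun t ht => by
      have := le_of_abs_le (abs_inv_apply_diag_le (hs.posDef t ht)
        (sigma_isSymm (hs.posDef t ht) (hs.k_isSymm ht)) i)
      rw [← shearSq] at this
      linarith)
  obtain ⟨M₂, hM₂⟩ := hF.exists_bound_div_sq hy hC (fun t ht => hs.metric_eq t ht j j)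
    (fun t ht => (hs.posDef t ht).diag_pos.le) (fun t ht => by
      have := neg_le_of_abs_le (abs_apply_diag_le (hs.posDef t ht)
        (sigma_isSymm (hs.posDef t ht) (hs.k_isSymm ht)) j)
      rw [← shearSq] at this
      simp only [sigma, Matrix.add_apply, Matrix.smul_apply, smul_eq_mul] at this
      linarith)
  refine ⟨1 / 2 * √M * (M₁ + M₂), fun t ht => ?_⟩
  have htp := hF.time_pos ht
  have hH := hF.H_pos ht
  have hg := hs.posDef t ht
  have e : t ^ (-2 : ℝ) = (t ^ 2)⁻¹ := by
    rw [Real.rpow_neg htp.le]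
    norm_num
  have h1 : √(shearSq (g t) (k t)) / hubble (g t) (k t) ≤ √M * t ^ (-2 : ℝ) := by
    rw [e, ← div_eq_mul_inv, le_div_iff₀ (by positivity)]
    refine Real.le_sqrt_of_sq_le ?_
    rw [mul_pow, div_pow, Real.sq_sqrt (hF.w_nonneg t ht)]
    linarith [hM t ht]
  have h2 : 0 ≤ t ^ 2 * (g t)⁻¹ i i + g t j j / t ^ 2 := by
    have p1 := hg.inv.diag_pos (i := i)
    have p2 := hg.diag_pos (i := j)
    positivity
  calc _ ≤ 1 / 2 * (√(shearSq (g t) (k t)) / hubble (g t) (k t))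
        * (t ^ 2 * (g t)⁻¹ i i + g t j j / t ^ 2) :=
        abs_shear_apply_le hg (hs.k_isSymm ht) hH htp i j
    _ ≤ 1 / 2 * (√M * t ^ (-2 : ℝ)) * (M₁ + M₂) :=
        mul_le_mul (by linarith) (add_le_add (hM₁ t ht) (hM₂ t ht)) h2 (by positivity)
    _ = _ := by ring

end IsBianchiV

/-! ### Late-time asymptotics and quantitative stability. -/

theorem isBigO_rpow_of_abs_le {t₀ C m m' : ℝ} {u : ℝ → ℝ} (h : ∀ t ∈ Ici t₀, |u t| ≤ C * t ^ m')
    (hm : m' ≤ m) : u =O[atTop] fun t : ℝ => t ^ m := by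
  refine Asymptotics.IsBigO.of_bound |C| ?_
  filter_upwards [eventually_ge_atTop t₀, eventually_ge_atTop 1] with t ht ht1
  have h1 : t ^ m' ≤ t ^ m := Real.rpow_le_rpow_of_exponent_le ht1 hm
  have h2 : 0 ≤ t ^ m' := by positivity
  rw [Real.norm_eq_abs, Real.norm_eq_abs, abs_of_nonneg (h2.trans h1)]
  exact (h t ht).trans ((mul_le_mul_of_nonneg_right (le_abs_self C) h2).trans
    (mul_le_mul_of_nonneg_left h1 (abs_nonneg C)))

theorem tendsto_zero_of_abs_le {t₀ C m : ℝ} {u : ℝ → ℝ} (h : ∀ t ∈ Ici t₀, |u t| ≤ C * t ^ (-m))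
    (hm : 0 < m) : Tendsto u atTop (𝓝 0) :=
  (isBigO_rpow_of_abs_le h le_rfl).trans_tendsto (tendsto_rpow_neg_atTop hm)

namespace IsBianchiV

variable {t₀ : ℝ} {g k : ℝ → Mat} {f : ℝ → Mom → ℝ}

/-- Decay towards the Milne solution for data close to it. -/
theorem exists_decay (h : IsBianchiV t₀ g k f)
    (hd : SmallData (1 / 1000) (g t₀) (k t₀) (f t₀)) :
    (∃ C, ∀ t ∈ Ici t₀, |t * hubble (g t) (k t) - 1| ≤ C * t ^ (-(1 / 2) : ℝ)) ∧
    (∃ C, ∀ t ∈ Ici t₀, |varAtilde (g t) (k t)| ≤ C * t ^ (-(1 / 2) : ℝ)) ∧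
    (∃ C, ∀ t ∈ Ici t₀, |supMom (g t) (f t)| ≤ C * t ^ (-(7 / 8) : ℝ)) ∧
    ∀ i j, ∃ C, ∀ t ∈ Ici t₀, |Shear (g t) (k t) i j| ≤ C * t ^ (-2 : ℝ) := by
  have hF := h.shearFlow
  obtain ⟨hy, hN⟩ := h.small_data_bounds hd le_rfl
  obtain ⟨C, hC, hyC⟩ := hF.exists_deficit_le (fun t ht => (hy t ht).le) fun t ht =>
    h.abs_current_le ht (by norm_num) (hN t ht)
  obtain ⟨B, hB, hNB⟩ := h.exists_normSq_decay fun t ht => (hy t ht).le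
  refine ⟨⟨4 * C, fun t ht => ?_⟩, ⟨C, fun t ht => ?_⟩, ⟨√B, fun t ht => ?_⟩, fun i j =>
    h.exists_shear_decay hC hyC hB hNB i j⟩
  · rw [abs_sub_comm, abs_of_nonneg (by linarith [hF.mul_H_le_one ht])]
    exact hF.one_sub_mul_H_le hyC hC ht
  · rw [varAtilde, varA_eq (h.solution.posDef t ht), abs_of_nonneg (hF.deficit_nonneg ht)]
    exact hyC t ht
  · have htp := hF.time_pos ht
    rw [abs_of_nonneg supMom_nonneg]
    refine (supMom_le (hNB t ht)).trans_eq ?_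
    rw [Real.sqrt_mul hB.le, Real.sqrt_eq_rpow (t ^ (-(7 / 4) : ℝ)), ← Real.rpow_mul htp.le]
    norm_num

/-- Quantitative stability of the Milne solution. -/
theorem stability (h : IsBianchiV t₀ g k f) {δ : ℝ} (hδ : δ ≤ 1 / 1000)
    (hd : SmallData δ (g t₀) (k t₀) (f t₀)) {t : ℝ} (ht : t ∈ Ici t₀) :
    |t * hubble (g t) (k t) - 1| < 2 * δ ∧ shearNorm (g t) (k t) < √(6 * δ) ∧
      |varA (g t) (k t) - 1| < δ ∧ supMom (g t) (f t) ≤ δ := by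
  have hF := h.shearFlow
  obtain ⟨hy, hN⟩ := h.small_data_bounds hd hδ
  have hδ0 : 0 < δ := (abs_nonneg _).trans_lt hd.plus
  have hH := hF.H_pos ht
  refine ⟨?_, ?_, ?_, ?_⟩
  · rw [abs_sub_comm, abs_of_nonneg (by linarith [hF.mul_H_le_one ht])]
    -- The maximum over a compact interval is attained, so the strict bound on the deficit becomes a
    -- uniform one with `c < δ`.
    obtain ⟨c, hc, hcδ⟩ : ∃ c, (∀ s ∈ Icc t₀ t, 1 - (g s)⁻¹ 0 0 / hubble (g s) (k s) ^ 2 ≤ c)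
        ∧ c < δ := by
      obtain ⟨s, hs, hmax⟩ := isCompact_Icc.exists_isMaxOn ⟨t, right_mem_Icc.mpr ht⟩
        (hF.continuousOn_deficit.mono Icc_subset_Ici_self)
      exact ⟨_, fun r hr => hmax hr, hy s hs.1⟩
    have h1 := hF.one_le_mul_H ht hc
    have hc0 : 0 ≤ c := (hF.deficit_nonneg ht).trans (hc t (right_mem_Icc.mpr ht))
    have h2 := mul_le_mul_of_nonneg_left (hF.mul_H_le_one ht) hc0
    linarith
  · rw [shearNorm_eq hH]
    have h0 := hF.deficit_nonneg ht
    have h1 := hF.sqrt_w_le ht (Real.sqrt_nonneg _) (Real.sq_sqrt (mul_nonneg (by norm_num) h0)).ge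
    rw [← div_le_iff₀ hH] at h1
    exact h1.trans_lt (Real.sqrt_lt_sqrt (by positivity) (by linarith [hy t ht]))
  · rw [varA_eq (h.solution.posDef t ht), abs_sub_comm, abs_of_nonneg (hF.deficit_nonneg ht)]
    exact hy t ht
  · refine (supMom_le fun p hp => (hN t ht p hp).le).trans_eq (Real.sqrt_sq hδ0.le)

end IsBianchiV

end

end Bianchi

theorem mainTheorem1 :
    -- uniform smallness threshold `δ₀` and decay exponents `0 < ε ≤ ε₀`
    ∃ ε₀ > (0 : ℝ), ∃ δ₀ > (0 : ℝ),
      (∀ (t₀ : ℝ) (g k : ℝ → Bianchi.Mat) (f : ℝ → Bianchi.Mom → ℝ),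
        Bianchi.IsBianchiV t₀ g k f → Bianchi.SmallData δ₀ (g t₀) (k t₀) (f t₀) →
        -- late-time estimates
        (∀ ε : ℝ, 0 < ε → ε ≤ ε₀ →
          (fun t => t * Bianchi.hubble (g t) (k t) - 1) =O[atTop] (fun t : ℝ => t ^ (-ε)) ∧
          (fun t => Bianchi.shearPlus (g t) (k t)) =O[atTop] (fun t : ℝ => t ^ (-2 : ℝ)) ∧
          (fun t => Bianchi.shearMinus (g t) (k t)) =O[atTop] (fun t : ℝ => t ^ (-2 : ℝ)) ∧
          (∀ i j : Fin 3, i ≠ j →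
            (fun t => Bianchi.Shear (g t) (k t) i j) =O[atTop] (fun t : ℝ => t ^ (-2 : ℝ))) ∧
          (fun t => Bianchi.varAtilde (g t) (k t)) =O[atTop] (fun t : ℝ => t ^ (-ε)) ∧
          (fun t => Bianchi.supMom (g t) (f t)) =O[atTop] (fun t : ℝ => t ^ (-(1 / 2) : ℝ))) ∧
        -- the solution tends to the Milne solution, for which `H = 1/t`, `Σ^a_b = 0` and `A = 1`
        Tendsto (fun t => t * Bianchi.hubble (g t) (k t)) atTop (𝓝 1) ∧
        (∀ a b : Fin 3, Tendsto (fun t => Bianchi.Shear (g t) (k t) a b) atTop (𝓝 0)) ∧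
        Tendsto (fun t => Bianchi.varA (g t) (k t)) atTop (𝓝 1) ∧
        Tendsto (fun t => Bianchi.supMom (g t) (f t)) atTop (𝓝 0)) ∧
      -- stability: solutions that start close to the Milne solution stay close to it
      (∀ η > (0 : ℝ), ∃ δ > (0 : ℝ),
        ∀ (t₀ : ℝ) (g k : ℝ → Bianchi.Mat) (f : ℝ → Bianchi.Mom → ℝ),
          Bianchi.IsBianchiV t₀ g k f → Bianchi.SmallData δ (g t₀) (k t₀) (f t₀) →
          ∀ t, t₀ ≤ t →
            |t * Bianchi.hubble (g t) (k t) - 1| < η ∧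
            Bianchi.shearNorm (g t) (k t) < η ∧
            |Bianchi.varA (g t) (k t) - 1| < η ∧
            Bianchi.supMom (g t) (f t) < η) := by
  -- `1/2` is the decay exponent obtained for the deficit, and `1/1000` the threshold under which
  -- its damping holds.
  refine ⟨1 / 2, by norm_num, 1 / 1000, by norm_num, fun t₀ g k f h hd => ?_, fun η hη => ?_⟩
  · obtain ⟨⟨C₁, h₁⟩, ⟨C₂, h₂⟩, ⟨C₃, h₃⟩, h₄⟩ := h.exists_decay hd
    choose C₄ h₄ using h₄
    have hO := fun i j => Bianchi.isBigO_rpow_of_abs_le (h₄ i j) le_rfl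
    refine ⟨fun ε _ hε => ⟨Bianchi.isBigO_rpow_of_abs_le h₁ (by linarith), ?_, ?_,
      fun i j _ => hO i j, Bianchi.isBigO_rpow_of_abs_le h₂ (by linarith),
      Bianchi.isBigO_rpow_of_abs_le h₃ (by norm_num)⟩, ?_, ?_, ?_, ?_⟩
    · exact ((hO 1 1).add (hO 2 2)).const_mul_left _
    · exact ((hO 1 1).sub (hO 2 2)).const_mul_left _
    · have := (Bianchi.tendsto_zero_of_abs_le h₁ (by norm_num)).add_const 1
      simpa using this
    · exact fun i j => Bianchi.tendsto_zero_of_abs_le (h₄ i j) (by norm_num)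
    · have := (Bianchi.tendsto_zero_of_abs_le h₂ (by norm_num)).const_sub 1
      simpa [Bianchi.varAtilde] using this
    · exact Bianchi.tendsto_zero_of_abs_le h₃ (by norm_num)
  -- `η/2` serves `t H`, `A` and `P`; `η²/6` serves the shear, which is bounded only by `√(6 δ)`.
  · refine ⟨min (1 / 1000) (min (η / 2) (η ^ 2 / 6)), by positivity, fun t₀ g k f h hd t ht => ?_⟩
    obtain ⟨h₁, h₂, h₃, h₄⟩ := h.stability (min_le_left _ _) hd ht
    have hη₁ : min (1 / 1000) (min (η / 2) (η ^ 2 / 6)) ≤ η / 2 :=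
      (min_le_right _ _).trans (min_le_left _ _)
    have hη₂ : min (1 / 1000) (min (η / 2) (η ^ 2 / 6)) ≤ η ^ 2 / 6 :=
      (min_le_right _ _).trans (min_le_right _ _)
    refine ⟨by linarith, h₂.trans_le ?_, by linarith, by linarith⟩
    exact Real.sqrt_le_iff.mpr ⟨hη.le, by linarith⟩
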